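/- Let $q\in\mathbb C$ with $0<|q|<1$, and put $\Omega_q:=\{q^{-k}:k=0,1,2,\dots\}$. Write $(a;q)_n:=\prod_{j=0}^{n-1}(1-aq^j)$, $(a;q)_\infty:=\prod_{j\ge 0}(1-aq^j)$, $(a_1,\dots,a_k;q)_n:=\prod_{i}(a_i;q)_n$ (also for $n=\infty$), $\vartheta(x;q):=(x,q/x;q)_\infty$ for $x\ne0$ and $\vartheta(x,y;q):=\vartheta(x;q)\vartheta(y;q)$. A list of parameters inside a symbol stands for all its entries; $x\mathbf a$, $\mathbf a/x$, $x/\mathbf a$ are formed entrywise, and $\mathbf c_{[k]}$ is $\mathbf c$ with $c_k$ removed. Let $${}_{r+1}\phi_s\!\left({a_1,\dots,a_{r+1}\atop b_1,\dots,b_s};q,x\right):=\sum_{k\ge0}\frac{(a_1,\dots,a_{r+1};q)_k}{(q,b_1,\dots,b_s;q)_k}\left((-1)^kq^{\binom k2}\right)^{s-r}x^k ,$$ and for $p\ge 0$ let ${}_{r+1}\phi_s^{-p}$ (resp. ${}_{r+1}\phi_s^{\,p}$) be the series obtained from ${}_{r+1}\phi_s$ by adjoining $p$ further numerator (resp. denominator)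 parameters equal to $0$ (so that the indices $r+1$, $s$ in the defining formula grow accordingly). Let $A,C\ge0$ be integers, $\mathbf a=(a_1,\dots,a_A)$ and $\mathbf c=(c_1,\dots,c_C)$ finite lists of complex numbers, $d_1,d_2,f\in\mathbb C\setminus\{0\}$, $\mathbf d=(d_1,d_2)$ and $\sigma\in(0,\infty)$, with $|c_k|<\sigma$ for all $k$ and $|d_1|,|d_2|<1/\sigma$. With $z=e^{i\psi}$ put $$I:=\int_{-\pi}^{\pi}\frac{\left((fd_1,\frac qf d_2)\frac{\sigma}{z},(\frac f{d_2},\frac q{fd_1},\mathbf a)\frac z\sigma;q\right)_\infty}{\left((d_1,d_2)\frac\sigma z,\mathbf c\frac z\sigma;q\right)_\infty}\,d\psi .$$ The integrand is integrable on $[-\pi,\pi]$, and the following hold. (i) Suppose $d_1/d_2,\,d_2/d_1\notin\Omega_q$ and $d_la_i\notin\Omega_q$ for all $l\in\{1,2\}$ and all $i$. Then both series below converge, and $$I=\frac{2\pi\,\vartheta(f,f\frac{d_1}{d_2};q)}{(q;q)_\infty}\,H,$$ where $$H:=\frac{(d_1\mathbf a;q)_\infty}{(\frac{d_2}{d_1},d_1\mathbf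 c;q)_\infty}\;{}_{C}\phi_{A+1}^{C-A-2}\!\left({d_1\mathbf c\atop d_1\mathbf a,\,qd_1/d_2};q,q\right)+\frac{(d_2\mathbf a;q)_\infty}{(\frac{d_1}{d_2},d_2\mathbf c;q)_\infty}\;{}_{C}\phi_{A+1}^{C-A-2}\!\left({d_2\mathbf c\atop d_2\mathbf a,\,qd_2/d_1};q,q\right).$$ (ii) Suppose $C\ge A+2$, all $a_i$ and $c_k$ are nonzero, $c_k/c_{k'}\notin\Omega_q$ for $k\ne k'$, and, in case $C=A+2$, $|q\,a_1\cdots a_A|<|d_1d_2\,c_1\cdots c_C|$. Then every series below converges (and for $C>A+2$ each ${}_{A+2}\phi_{C-1}$ below, as a function of its argument, converges everywhere and is entire), and $$I=\frac{2\pi}{(q;q)_\infty}\,J,$$ where $$J:=\sum_{k=1}^{C}\frac{\vartheta(fc_kd_1,\frac f{c_kd_2};q)\,(\mathbf a/c_k;q)_\infty}{(c_k\mathbf d,\mathbf c_{[k]}/c_k;q)_\infty}\;{}_{A+2}\phi_{C-1}\!\left({c_k\mathbf d,\,qc_k/\mathbf a\atop qc_k/\mathbf c_{[k]}};q,\frac{q(qc_k)^{C-A-2}a_1\cdots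 a_A}{d_1d_2\,c_1\cdots c_C}\right).$$ -/

import Mathlib

open MeasureTheory

noncomputable section

namespace QHyp

/-- The set `Ω_q = {q^{-k} : k = 0, 1, 2, …}`. -/
def Omega (q : ℂ) : Set ℂ := {x | ∃ k : ℕ, x = (q ^ k)⁻¹}

/-- The finite `q`-shifted factorial `(a;q)_n = (1-a)(1-aq)⋯(1-aq^{n-1})`. -/
def poch (a q : ℂ) (n : ℕ) : ℂ := ∏ j ∈ Finset.range n, (1 - a * q ^ j)

/-- The infinite `q`-shifted factorial `(a;q)_∞`. -/
def pochInf (a q : ℂ) : ℂ := ∏' n : ℕ, (1 - a * q ^ n)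

/-- `(a_1,…,a_k;q)_n` for a finite multiset of parameters. -/
def pochM (S : Multiset ℂ) (q : ℂ) (n : ℕ) : ℂ := (S.map fun x => poch x q n).prod

/-- `(a_1,…,a_k;q)_∞` for a finite multiset of parameters. -/
def pochInfM (S : Multiset ℂ) (q : ℂ) : ℂ := (S.map fun x => pochInf x q).prod

/-- The modified theta function `ϑ(x;q) = (x, q/x; q)_∞`. -/
def theta (x q : ℂ) : ℂ := pochInf x q * pochInf (q / x) q

/-- The `k`-th term of the basic hypergeometric series `_{r+1}φ_s(as; bs; q, z)`, where
`r + 1 = card as` and `s = card bs`, so that `s - r = card bs + 1 - card as`. -/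
def phiTerm (as bs : Multiset ℂ) (q z : ℂ) (k : ℕ) : ℂ :=
  pochM as q k / (poch q q k * pochM bs q k)
    * ((-1) ^ k * q ^ (k.choose 2)) ^ ((Multiset.card bs : ℤ) + 1 - (Multiset.card as : ℤ))
    * z ^ k

/-- The basic hypergeometric series `_{r+1}φ_s(as; bs; q, z)`. -/
def phi (as bs : Multiset ℂ) (q z : ℂ) : ℂ := ∑' k : ℕ, phiTerm as bs q z k

/-- Terms of the series `_{r+1}φ_s^m`: for `m = -p ≤ 0`, `p` zeros are appended to the numerator
parameters; for `m = p ≥ 0`, `p` zeros are appended to the denominator parameters. -/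
def phiZTerm (m : ℤ) (as bs : Multiset ℂ) (q z : ℂ) (k : ℕ) : ℂ :=
  phiTerm (as + Multiset.replicate (-m).toNat 0) (bs + Multiset.replicate m.toNat 0) q z k

/-- The van de Bult--Rains series `_{r+1}φ_s^m(as; bs; q, z)`. -/
def phiZ (m : ℤ) (as bs : Multiset ℂ) (q z : ℂ) : ℂ :=
  phi (as + Multiset.replicate (-m).toNat 0) (bs + Multiset.replicate m.toNat 0) q z

/-- The multiset `{a_1, …, a_n}`. -/
def params {n : ℕ} (a : Fin n → ℂ) : Multiset ℂ := Finset.univ.val.map a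

/-- The multiset `{a_1, …, a_n}` with the entry of index `k` removed. -/
def paramsErase {n : ℕ} (a : Fin n → ℂ) (k : Fin n) : Multiset ℂ :=
  (Finset.univ.erase k).val.map a

/-- `b 𝐚 = {b a_1, …, b a_n}`. -/
def smulM (b : ℂ) (S : Multiset ℂ) : Multiset ℂ := S.map fun x => b * x

/-- `𝐚 / b = {a_1 / b, …, a_n / b}`. -/
def divM (S : Multiset ℂ) (b : ℂ) : Multiset ℂ := S.map fun x => x / b

/-- `b / 𝐚 = {b / a_1, …, b / a_n}`. -/
def divByM (b : ℂ) (S : Multiset ℂ) : Multiset ℂ := S.map fun x => b / x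

/-- The integrand, with `z = e^{iψ}`. -/
def integrand {A C : ℕ} (a : Fin A → ℂ) (c : Fin C → ℂ) (d₁ d₂ f q : ℂ) (σ : ℝ) (ψ : ℝ) : ℂ :=
  let z : ℂ := Complex.exp (Complex.I * ψ)
  (pochInfM (smulM (σ / z) {f * d₁, q / f * d₂}) q
      * pochInfM (smulM (z / σ) ({f / d₂, q / (f * d₁)} + params a)) q)
    / (pochInfM (smulM (σ / z) {d₁, d₂}) q * pochInfM (smulM (z / σ) (params c)) q)

/-- The terms of the argument `q` series in the first summand of `H`. -/
def hTerm {A C : ℕ} (a : Fin A → ℂ) (c : Fin C → ℂ) (d₁ d₂ q : ℂ) (k : ℕ) : ℂ :=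
  phiZTerm ((C : ℤ) - A - 2) (smulM d₁ (params c))
    (smulM d₁ (params a) + {q * d₁ / d₂}) q q k

/-- The first summand of `H`; the second one is obtained by interchanging `d₁` and `d₂`. -/
def hSummand {A C : ℕ} (a : Fin A → ℂ) (c : Fin C → ℂ) (d₁ d₂ q : ℂ) : ℂ :=
  pochInfM (smulM d₁ (params a)) q
    / (pochInf (d₂ / d₁) q * pochInfM (smulM d₁ (params c)) q)
    * phiZ ((C : ℤ) - A - 2) (smulM d₁ (params c))
        (smulM d₁ (params a) + {q * d₁ / d₂}) q q

/-- `H(𝐚, 𝐜, 𝐝; q)`, the symmetric sum over `{d₁, d₂}`. -/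
def H {A C : ℕ} (a : Fin A → ℂ) (c : Fin C → ℂ) (d₁ d₂ q : ℂ) : ℂ :=
  hSummand a c d₁ d₂ q + hSummand a c d₂ d₁ q

/-- Numerator parameters `c_k 𝐝, q c_k / 𝐚` of the `k`-th series in `J`. -/
def jNum {A C : ℕ} (a : Fin A → ℂ) (c : Fin C → ℂ) (d₁ d₂ q : ℂ) (k : Fin C) : Multiset ℂ :=
  smulM (c k) {d₁, d₂} + divByM (q * c k) (params a)

/-- Denominator parameters `q c_k / 𝐜_{[k]}` of the `k`-th series in `J`. -/
def jDen {C : ℕ} (c : Fin C → ℂ) (q : ℂ) (k : Fin C) : Multiset ℂ :=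
  divByM (q * c k) (paramsErase c k)

/-- The argument of the `k`-th series in `J` (used only for `C ≥ A + 2`). -/
def jArg {A C : ℕ} (a : Fin A → ℂ) (c : Fin C → ℂ) (d₁ d₂ q : ℂ) (k : Fin C) : ℂ :=
  q * (q * c k) ^ ((C : ℤ) - A - 2) * (∏ i, a i) / (d₁ * d₂ * ∏ j, c j)

/-- `J(𝐚, 𝐜, 𝐝; f, q)`. -/
def J {A C : ℕ} (a : Fin A → ℂ) (c : Fin C → ℂ) (d₁ d₂ f q : ℂ) : ℂ :=
  ∑ k : Fin C,
    theta (f * c k * d₁) q * theta (f / (c k * d₂)) q * pochInfM (divM (params a) (c k)) q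
      / (pochInfM (smulM (c k) {d₁, d₂}) q * pochInfM (divM (paramsErase c k) (c k)) q)
      * phi (jNum a c d₁ d₂ q k) (jDen c q k) q (jArg a c d₁ d₂ q k)

end QHyp

end

/-! In the variable w = z/σ the integrand is a quotient F(w) of products (xw;q)_∞ and (x/w;q)_∞, and
dψ = dw/(iw), so I is a contour integral of F(w)/w over |w| = 1/σ. As |c_k| < σ, the singularities
inside, apart from 0, lie at d_l q^n; the Ω_q conditions make these points distinct, hence the poles
at most simple. They accumulate at 0, so the contour is shrunk through circles |w| = ρ|q|^n that
avoid them.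

The measure dw/w is invariant under w ↦ qw, and F(qw)/F(w) tends to a constant L as w → 0. If |L| <
1, the integrals over the small circles decay geometrically and I is 2π times the sum of all
residues of F(w)/w (`integral_eq_sum_tsum_residues`, `exists_kernel_decay`, `integral_kernel`).

For w = z/σ one finds L = q, with no further condition, and the poles d_l q^n give (i). For w = σ/z
the poles inside are c_k q^n, and L is q a_1⋯a_A/(d_1 d_2 c_1⋯c_C) when C = A+2 and 0 when C > A+2;
this gives (ii) and explains its hypothesis.

It remains to recognise the residues as series terms. The four factors containing f pair into two
theta functions, one evaluated at xq^n and the other at yq^{-n}. By quasi-periodicity they leave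
theta values independent of n, times (y/x)^n and a power of q quadratic in n. Reversing the finite
products that arise from shifts by q^{-n} yields the other quadratic powers, and the balance is
exactly that of the stated series (`residue_eq_hTerm`, `residue_eq_phiTerm`). -/

noncomputable section

namespace QHyp

open Filter Topology

/-! ### q-shifted factorials and theta functions -/

section Pochhammer

variable {q : ℂ}

lemma summable_norm_mul_pow (hq1 : ‖q‖ < 1) (a : ℂ) : Summable fun n : ℕ => ‖-(a * q ^ n)‖ := by
  simpa [norm_mul] using
    (summable_geometric_of_lt_one (norm_nonneg q) hq1).mul_left ‖a‖

lemma multipliable_one_sub_mul_pow (hq1 : ‖q‖ < 1) (a : ℂ) :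
    Multipliable fun n : ℕ => 1 - a * q ^ n := by
  simpa [sub_eq_add_neg] using multipliable_one_add_of_summable (summable_norm_mul_pow hq1 a)

lemma tendsto_poch (hq1 : ‖q‖ < 1) (a : ℂ) :
    Tendsto (poch a q) atTop (𝓝 (pochInf a q)) :=
  (multipliable_one_sub_mul_pow hq1 a).hasProd.tendsto_prod_nat

lemma pochInf_eq_poch_mul (hq1 : ‖q‖ < 1) (a : ℂ) (n : ℕ) :
    pochInf a q = poch a q n * pochInf (a * q ^ n) q := by
  have h : Multipliable fun k : ℕ => 1 - a * q ^ (k + n) := by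
    simpa [pow_add, mul_assoc, mul_comm, mul_left_comm] using
      multipliable_one_sub_mul_pow hq1 (a * q ^ n)
  unfold pochInf poch
  rw [← Multipliable.prod_mul_tprod_nat_mul' (f := fun k : ℕ => 1 - a * q ^ k) (k := n) h]
  congr 1
  refine tprod_congr fun k => ?_
  ring

lemma poch_succ (a q : ℂ) (n : ℕ) : poch a q (n + 1) = poch a q n * (1 - a * q ^ n) := by
  simp [poch, Finset.prod_range_succ]

lemma poch_succ' (a q : ℂ) (n : ℕ) : poch a q (n + 1) = (1 - a) * poch (a * q) q n := by
  simp only [poch, Finset.prod_range_succ']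
  rw [mul_comm]
  congr 1
  · simp
  · refine Finset.prod_congr rfl fun k _ => ?_
    ring

lemma pochInf_eq_one_sub_mul (hq1 : ‖q‖ < 1) (a : ℂ) :
    pochInf a q = (1 - a) * pochInf (a * q) q := by
  simpa [poch] using pochInf_eq_poch_mul hq1 a 1

lemma one_sub_mul_pow_ne_zero {a : ℂ} (ha : a ∉ Omega q) (n : ℕ) :
    1 - a * q ^ n ≠ 0 := fun h => ha ⟨n, by
  refine eq_inv_of_mul_eq_one_left ?_
  linear_combination -h⟩

lemma pochInf_ne_zero (hq1 : ‖q‖ < 1) {a : ℂ} (ha : a ∉ Omega q) :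
    pochInf a q ≠ 0 := by
  unfold pochInf
  simp only [sub_eq_add_neg]
  refine tprod_one_add_ne_zero_of_summable (fun n => ?_) (summable_norm_mul_pow hq1 a)
  simpa [sub_eq_add_neg] using one_sub_mul_pow_ne_zero ha n

lemma poch_ne_zero {a : ℂ} (ha : a ∉ Omega q) (n : ℕ) : poch a q n ≠ 0 :=
  Finset.prod_ne_zero_iff.2 fun k _ => one_sub_mul_pow_ne_zero ha k

lemma notMem_Omega_of_norm_lt_one (hq0 : q ≠ 0) (hq1 : ‖q‖ < 1) {a : ℂ} (ha : ‖a‖ < 1) :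
    a ∉ Omega q := by
  rintro ⟨k, rfl⟩
  rw [norm_inv, norm_pow] at ha
  exact absurd ha (not_lt.2 (one_le_inv_iff₀.2
    ⟨pow_pos (norm_pos_iff.2 hq0) k, pow_le_one₀ (norm_nonneg q) hq1.le⟩))

lemma mul_notMem_Omega (hq0 : q ≠ 0) {a : ℂ} (ha : a ∉ Omega q) : q * a ∉ Omega q := by
  rintro ⟨k, hk⟩
  refine ha ⟨k + 1, ?_⟩
  rw [pow_succ, mul_inv, ← hk]
  field_simp

/-- On a ball of radius R the factors differ from 1 by at most R|q|^n, so the product converges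
locally uniformly there and the limit is holomorphic. -/
lemma differentiable_pochInf (hq1 : ‖q‖ < 1) : Differentiable ℂ fun a => pochInf a q := by
  have key : ∀ R : ℝ, DifferentiableOn ℂ (fun a => pochInf a q) (Metric.ball 0 R) := by
    intro R
    have h := Summable.hasProdLocallyUniformlyOn_nat_one_add (K := Metric.ball (0 : ℂ) R)
      (f := fun (n : ℕ) (a : ℂ) => -(a * q ^ n)) Metric.isOpen_ball
      (u := fun n => R * ‖q‖ ^ n)
      ((summable_geometric_of_lt_one (norm_nonneg q) hq1).mul_left R)
      (Eventually.of_forall fun n x hx => by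
        rw [norm_neg, norm_mul, norm_pow]
        exact mul_le_mul_of_nonneg_right (mem_ball_zero_iff.1 hx).le (by positivity))
      (fun n => by fun_prop)
    have h2 := h.tendstoLocallyUniformlyOn_finsetRange.differentiableOn
      (Eventually.of_forall fun n => by fun_prop) Metric.isOpen_ball
    simpa [pochInf, sub_eq_add_neg] using h2
  intro a
  exact (key (‖a‖ + 1)).differentiableAt (Metric.isOpen_ball.mem_nhds (by simp))

/-- Reversal of a finite `q`-shifted factorial. -/
lemma poch_mul_inv_pow (hq0 : q ≠ 0) {y : ℂ} (hy : y ≠ 0) (n : ℕ) :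
    poch (y * (q ^ n)⁻¹) q n
      = poch (q / y) q n * (y ^ n * ((-1) ^ n * q ^ n.choose 2)⁻¹ * (q ^ n)⁻¹) := by
  induction n with
  | zero => simp [poch]
  | succ n ih =>
    have h1 : y * (q ^ (n + 1))⁻¹ * q = y * (q ^ n)⁻¹ := by
      rw [pow_succ]; field_simp
    rw [poch_succ', h1, ih, poch_succ, Nat.choose_succ_succ' n 1, Nat.choose_one_right]
    have hm : ((-1 : ℂ)) ^ n ≠ 0 := pow_ne_zero _ (by norm_num)
    simp only [pow_succ, pow_add]
    field_simp
    ring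

lemma pochInf_mul_inv_pow (hq0 : q ≠ 0) (hq1 : ‖q‖ < 1) {y : ℂ} (hy : y ≠ 0) (n : ℕ) :
    pochInf (y * (q ^ n)⁻¹) q
      = pochInf y q * (poch (q / y) q n * (y ^ n * ((-1) ^ n * q ^ n.choose 2)⁻¹ * (q ^ n)⁻¹)) := by
  rw [pochInf_eq_poch_mul hq1 _ n, poch_mul_inv_pow hq0 hy, mul_assoc y,
    inv_mul_cancel₀ (pow_ne_zero n hq0), mul_one, mul_comm]

/-- The shift removes the factor 1 - x from one product and adds 1 - 1/x to the other, and x(1 -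
1/x) = -(1 - x). -/
lemma theta_mul_self (hq0 : q ≠ 0) (hq1 : ‖q‖ < 1) {x : ℂ} (hx : x ≠ 0) :
    theta (x * q) q * x = -theta x q := by
  unfold theta
  have h1 : q / (x * q) = x⁻¹ := by field_simp
  have h2 : q / x = x⁻¹ * q := by field_simp
  rw [h1, h2, pochInf_eq_one_sub_mul hq1 x, pochInf_eq_one_sub_mul hq1 x⁻¹]
  field_simp
  ring

lemma theta_mul_pow (hq0 : q ≠ 0) (hq1 : ‖q‖ < 1) {x : ℂ} (hx : x ≠ 0) (n : ℕ) :
    theta (x * q ^ n) q = theta x q * ((-1) ^ n * (q ^ n.choose 2)⁻¹ * (x ^ n)⁻¹) := by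
  induction n with
  | zero => simp
  | succ n ih =>
    have h := theta_mul_self hq0 hq1 (mul_ne_zero hx (pow_ne_zero n hq0))
    rw [ih, mul_assoc x, ← pow_succ] at h
    have hne := mul_ne_zero hx (pow_ne_zero n hq0)
    rw [← mul_left_inj' hne, h, Nat.choose_succ_succ' n 1, Nat.choose_one_right]
    simp only [pow_succ, pow_add]
    field_simp

/-- The quasi-periodicity factors of the two theta functions in the integrand cancel up to
`q ^ (-n²) (x / y) ^ n`. -/
lemma theta_mul_pow_mul_theta_mul_inv_pow (hq0 : q ≠ 0) (hq1 : ‖q‖ < 1) {x y : ℂ}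
    (hx : x ≠ 0) (hy : y ≠ 0) (n : ℕ) :
    theta (x * q ^ n) q * theta (y * (q ^ n)⁻¹) q
      = theta x q * theta y q * ((y / x) ^ n * (q ^ (2 * n.choose 2 + n))⁻¹) := by
  have hqn := pow_ne_zero n hq0
  have h := theta_mul_pow hq0 hq1 (mul_ne_zero hy (inv_ne_zero hqn)) n
  rw [inv_mul_cancel_right₀ hqn] at h
  have hsq : (q ^ n) ^ n = q ^ (2 * n.choose 2 + n) := by
    rw [← pow_mul, Nat.choose_two_right, Nat.mul_div_cancel' (Nat.even_mul_pred_self n).two_dvd]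
    congr 1
    cases n with
    | zero => rfl
    | succ n => simp; ring
  rw [theta_mul_pow hq0 hq1 hx, h, ← hsq]
  have hm : ((-1 : ℂ)) ^ n ≠ 0 := pow_ne_zero _ (by norm_num)
  rw [mul_pow, inv_pow, div_pow]
  field_simp

end Pochhammer

/-! ### Residue theorem for finitely many simple poles in an annulus -/

section Residue

open Metric Complex Function

/-- A function with an at most simple pole at `p` becomes differentiable after subtracting the
principal part and changing the value at `p`. -/
lemma exists_differentiableAt_sub_principalPart {F : ℂ → ℂ} {p R : ℂ}
    (hd : ∀ᶠ w in 𝓝[≠] p, DifferentiableAt ℂ F w)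
    (hR : Tendsto (fun w => (w - p) * F w) (𝓝[≠] p) (𝓝 R)) :
    ∃ G : ℂ → ℂ, DifferentiableAt ℂ G p ∧ ∀ w ≠ p, G w = F w - R / (w - p) := by
  set h : ℂ → ℂ := fun w => F w - R / (w - p) with hh
  refine ⟨update h p (limUnder (𝓝[≠] p) h), ?_, fun w hw => update_of_ne hw _ _⟩
  obtain ⟨s, hs, hsd⟩ := (eventually_nhdsWithin_iff.1 hd).exists_mem
  refine (Complex.differentiableOn_update_limUnder_of_isLittleO hs ?_ ?_).differentiableAt hs
  · intro w hw
    have hne : w - p ≠ 0 := sub_ne_zero.2 hw.2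
    exact ((hsd w hw.1 hw.2).sub (by fun_prop (disch := assumption))).differentiableWithinAt
  · have hne : ∀ᶠ w in 𝓝[≠] p, w - p ≠ 0 :=
      eventually_nhdsWithin_of_forall fun w hw => sub_ne_zero.2 hw
    refine (Asymptotics.isLittleO_iff_tendsto' (hne.mono fun w hw h0 =>
      absurd h0 (inv_ne_zero hw))).2 ?_
    -- The removable singularity criterion asks for h w - h p = o(1/(w - p)). The value h p is
    -- arbitrary (division by zero makes it F p), and the factor w - p removes its contribution.
    have h1 : Tendsto (fun w => (w - p) * F w - R - (w - p) * h p) (𝓝[≠] p)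
        (𝓝 (R - R - (p - p) * h p)) := by
      refine (hR.sub_const R).sub (Tendsto.mul_const _ ?_)
      exact ((continuous_id.sub continuous_const).tendsto p).mono_left nhdsWithin_le_nhds
    simp only [sub_self, zero_mul] at h1
    refine h1.congr' (hne.mono fun w hw => ?_)
    simp only [hh]
    field_simp

/-- The residue theorem for a function with finitely many simple poles in an annulus. -/
theorem circleIntegral_sub_eq_sum_residues {ι : Type*} (s : Finset ι) (p : ι → ℂ) (R : ι → ℂ)
    {r₁ r₂ : ℝ} (h1 : 0 < r₁) (h2 : r₁ ≤ r₂) (hinj : Set.InjOn p s)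
    (hp : ∀ i ∈ s, r₁ < ‖p i‖ ∧ ‖p i‖ < r₂) (F : ℂ → ℂ)
    (hd : ∀ w, r₁ ≤ ‖w‖ → ‖w‖ ≤ r₂ → (∀ i ∈ s, w ≠ p i) → DifferentiableAt ℂ F w)
    (hR : ∀ i ∈ s, Tendsto (fun w => (w - p i) * F w) (𝓝[≠] p i) (𝓝 (R i))) :
    (∮ w in C(0, r₂), F w) - (∮ w in C(0, r₁), F w) = 2 * Real.pi * I * ∑ i ∈ s, R i := by
  classical
  induction s using Finset.induction_on generalizing F with
  | empty =>
    have hd' : ∀ w ∈ closedBall (0 : ℂ) r₂ \ ball 0 r₁, DifferentiableAt ℂ F w := fun w hw =>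
      hd w (by simpa using hw.2) (by simpa using hw.1) (by simp)
    rw [circleIntegral_eq_of_differentiable_on_annulus_off_countable h1 h2 Set.countable_empty
      (fun w hw => (hd' w hw).continuousAt.continuousWithinAt)
      (fun w hw => hd' w ⟨ball_subset_closedBall hw.1.1, fun h => hw.1.2 (ball_subset_closedBall h)⟩)]
    simp
  | insert i s his ih =>
    have hpi := hp i (Finset.mem_insert_self i s)
    have hpne : ∀ k ∈ s, p i ≠ p k := fun k hk h => his <| by
      rwa [hinj (Finset.mem_coe.2 (Finset.mem_insert_self i s))
        (Finset.mem_coe.2 (Finset.mem_insert_of_mem hk)) h]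
    have hnear : ∀ᶠ w in 𝓝 (p i), r₁ ≤ ‖w‖ ∧ ‖w‖ ≤ r₂ ∧ ∀ k ∈ s, w ≠ p k := by
      refine ((continuous_norm.tendsto (p i)).eventually_const_le hpi.1).and
        (((continuous_norm.tendsto (p i)).eventually_le_const hpi.2).and ?_)
      exact (Finset.eventually_all s).2 fun k hk => eventually_ne_nhds (hpne k hk)
    obtain ⟨G, hGd, hG⟩ := exists_differentiableAt_sub_principalPart (F := F) (p := p i) (R := R i)
      (by
        rw [eventually_nhdsWithin_iff]
        filter_upwards [hnear] with w hw hwp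
        exact hd w hw.1 hw.2.1 (Finset.forall_mem_insert _ _ _ |>.2 ⟨hwp, hw.2.2⟩))
      (hR i (Finset.mem_insert_self i s))
    have hGdiff : ∀ w, w ≠ p i → DifferentiableAt ℂ F w → DifferentiableAt ℂ G w := by
      intro w hw hF
      have hne : w - p i ≠ 0 := sub_ne_zero.2 hw
      have h3 : DifferentiableAt ℂ (fun w => F w - R i / (w - p i)) w :=
        hF.sub (by fun_prop (disch := assumption))
      exact h3.congr_of_eventuallyEq ((eventually_ne_nhds hw).mono fun v hv => hG v hv)
    -- G is regular at `p i` and has unchanged residues at the remaining points, since the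
    -- subtracted principal part is regular there; the induction hypothesis therefore applies to G.
    have key := ih (hinj.mono (by simp)) (fun k hk => hp k (Finset.mem_insert_of_mem hk)) G
      (fun w hw1 hw2 hw3 => by
        by_cases hw : w = p i
        · exact hw ▸ hGd
        · exact hGdiff w hw (hd w hw1 hw2 (Finset.forall_mem_insert _ _ _ |>.2 ⟨hw, hw3⟩)))
      (fun k hk => by
        have hki := (hpne k hk).symm
        have hki' : p k - p i ≠ 0 := sub_ne_zero.2 hki
        have h3 : Tendsto (fun w => (w - p k) * F w - (w - p k) * (R i / (w - p i)))
            (𝓝[≠] p k) (𝓝 (R k - (p k - p k) * (R i / (p k - p i)))) := by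
          refine (hR k (Finset.mem_insert_of_mem hk)).sub ?_
          have hc : ContinuousAt (fun w => (w - p k) * (R i / (w - p i))) (p k) := by
            fun_prop (disch := assumption)
          exact hc.tendsto.mono_left nhdsWithin_le_nhds
        rw [sub_self, zero_mul, sub_zero] at h3
        refine h3.congr' ?_
        filter_upwards [nhdsWithin_le_nhds (eventually_ne_nhds hki)] with w hw
        rw [hG w hw]
        ring)
    have hcirc : ∀ r : ℝ, 0 < r → r₁ ≤ r → r ≤ r₂ → (∀ k ∈ insert i s, r ≠ ‖p k‖) →
        (∮ w in C(0, r), F w) = (∮ w in C(0, r), G w) + R i * ∮ w in C(0, r), (w - p i)⁻¹ := by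
      intro r hr hr1 hr2 hrp
      have hs : ∀ w ∈ sphere (0 : ℂ) r, ∀ k ∈ insert i s, w ≠ p k := by
        rintro w hw k hk rfl
        exact hrp k hk (by simpa using hw.symm)
      have hcF : ∀ w ∈ sphere (0 : ℂ) r, DifferentiableAt ℂ F w := fun w hw =>
        hd w (by rw [mem_sphere_zero_iff_norm.1 hw]; exact hr1)
          (by rw [mem_sphere_zero_iff_norm.1 hw]; exact hr2) (hs w hw)
      have hGi : CircleIntegrable G 0 r := ContinuousOn.circleIntegrable hr.le fun w hw =>
        (hGdiff w (hs w hw i (Finset.mem_insert_self i s)) (hcF w hw)).continuousAt.continuousWithinAt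
      have hPi : CircleIntegrable (fun w => R i * (w - p i)⁻¹) 0 r := by
        refine ContinuousOn.circleIntegrable hr.le fun w hw => ?_
        have hne : w - p i ≠ 0 := sub_ne_zero.2 (hs w hw i (Finset.mem_insert_self i s))
        exact ContinuousAt.continuousWithinAt (by fun_prop (disch := assumption))
      rw [← circleIntegral.integral_const_mul, ← circleIntegral.integral_add hGi hPi]
      refine circleIntegral.integral_congr hr.le fun w hw => ?_
      rw [hG w (hs w hw i (Finset.mem_insert_self i s))]
      ring
    have hI2 : (∮ w in C(0, r₂), (w - p i)⁻¹) = 2 * Real.pi * I :=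
      circleIntegral.integral_sub_inv_of_mem_ball (by simpa using hpi.2)
    have hI1 : (∮ w in C(0, r₁), (w - p i)⁻¹) = 0 := by
      have hne : ∀ w ∈ closedBall (0 : ℂ) r₁, w - p i ≠ 0 := by
        intro w hw h
        rw [sub_eq_zero] at h
        rw [h, mem_closedBall_zero_iff] at hw
        exact absurd hw (not_le.2 hpi.1)
      refine circleIntegral_eq_zero_of_differentiable_on_off_countable h1.le Set.countable_empty
        (fun w hw => ?_) (fun w hw => ?_)
      · have := hne w hw
        exact ContinuousAt.continuousWithinAt (by fun_prop (disch := assumption))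
      · have := hne w (ball_subset_closedBall hw.1)
        fun_prop (disch := assumption)
    rw [hcirc r₂ (h1.trans_le h2) h2 le_rfl fun k hk => (hp k hk).2.ne',
      hcirc r₁ h1 le_rfl h2 fun k hk => (hp k hk).1.ne, hI1, hI2, Finset.sum_insert his, mul_add,
      ← key]
    ring

end Residue

/-! ### Poles in geometric progressions accumulating at the origin -/

section GeometricPoles

open Metric Complex

lemma pow_left_injective_of_norm_lt_one {q : ℂ} (hq0 : q ≠ 0) (hq1 : ‖q‖ < 1) :
    Function.Injective fun n : ℕ => q ^ n := by
  intro n k h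
  have h' : ‖q‖ ^ n = ‖q‖ ^ k := by simpa using congrArg norm h
  exact (pow_right_strictAnti₀ (norm_pos_iff.2 hq0) hq1).injective h'

/-- If e_i q^n = e_j q^k with n ≤ k, then e_j/e_i = q^{-(k-n)} lies in Ω_q, which forces i = j;
strict decrease of |q|^n then gives n = k. This is what keeps the poles distinct. -/
lemma mul_pow_injective {q : ℂ} (hq0 : q ≠ 0) (hq1 : ‖q‖ < 1) {m : ℕ} {e : Fin m → ℂ}
    (he0 : ∀ j, e j ≠ 0) (hne : ∀ i j, i ≠ j → e i / e j ∉ Omega q) :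
    Function.Injective fun x : Fin m × ℕ => e x.1 * q ^ x.2 := by
  have aux : ∀ i j : Fin m, ∀ n k : ℕ, n ≤ k → e i * q ^ n = e j * q ^ k → i = j := by
    intro i j n k hnk h
    by_contra hij
    refine hne j i (Ne.symm hij) ⟨k - n, ?_⟩
    obtain ⟨l, rfl⟩ := Nat.exists_eq_add_of_le hnk
    have hqn := pow_ne_zero n hq0
    have hql := pow_ne_zero l hq0
    have hi := he0 i
    rw [Nat.add_sub_cancel_left, div_eq_iff hi, eq_comm, inv_mul_eq_iff_eq_mul₀ hql]
    rw [pow_add] at h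
    apply mul_right_cancel₀ hqn
    linear_combination h
  rintro ⟨i, n⟩ ⟨j, k⟩ h
  have hij : i = j := by
    rcases le_total n k with hnk | hnk
    · exact aux i j n k hnk h
    · exact (aux j i k n hnk (Eq.symm h)).symm
  subst hij
  have := pow_left_injective_of_norm_lt_one hq0 hq1 (mul_left_cancel₀ (he0 i) h)
  simp_all

/-- On the circle dw/w = i dψ, so the radius drops out; periodicity moves the interval from [0, 2π]
to [-π, π]. -/
lemma circleIntegral_div_eq (F : ℂ → ℂ) {r : ℝ} (hr : r ≠ 0) :
    (∮ w in C(0, r), F w / w) = I * ∫ ψ in (-Real.pi)..Real.pi, F (r * exp (I * ψ)) := by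
  have hper : Function.Periodic (fun ψ : ℝ => F (r * exp (I * ψ))) (2 * Real.pi) := by
    intro ψ
    simp only
    congr 2
    push_cast
    rw [mul_add, show I * (2 * (Real.pi : ℂ)) = 2 * Real.pi * I by ring, exp_periodic]
  have h := hper.intervalIntegral_add_eq 0 (-Real.pi)
  rw [zero_add, show -Real.pi + 2 * Real.pi = Real.pi by ring] at h
  rw [← h, circleIntegral, ← intervalIntegral.integral_const_mul]
  refine intervalIntegral.integral_congr fun ψ _ => ?_
  have hrc : (r : ℂ) ≠ 0 := by exact_mod_cast hr
  simp only [deriv_circleMap, circleMap, zero_add, smul_eq_mul, mul_comm (ψ : ℂ) I]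
  have := exp_ne_zero (I * ψ)
  field_simp

/-- Some radius `ρ` is such that no circle `‖w‖ = ρ ‖q‖ ^ n` meets the geometric progressions
`e j * q ^ k`. -/
lemma exists_radius_avoiding (q : ℂ) (hq0 : q ≠ 0) {m : ℕ} (e : Fin m → ℂ) {ρ₀ : ℝ}
    (hρ₀ : 0 < ρ₀) :
    ∃ ρ, 0 < ρ ∧ ρ < ρ₀ ∧ ∀ (j : Fin m) (n k : ℕ), ρ * ‖q‖ ^ n ≠ ‖e j * q ^ k‖ := by
  -- Only countably many radii are bad, so good ones are dense.
  have hcount : (Set.range fun x : Fin m × ℕ × ℕ =>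
      ‖e x.1 * q ^ x.2.1‖ / ‖q‖ ^ x.2.2).Countable := Set.countable_range _
  obtain ⟨ρ, hρ, h1, h2⟩ := (hcount.dense_compl ℝ).exists_between hρ₀
  refine ⟨ρ, h1, h2, fun j n k h => hρ ⟨(j, k, n), ?_⟩⟩
  simp only
  rw [← h, mul_div_cancel_right₀]
  exact pow_ne_zero n (norm_ne_zero_iff.2 hq0)

/-- Circle integral of a function whose singularities inside the circle, apart from the origin, are
simple poles in finitely many geometric progressions of ratio `q`, and which decays along them. -/
theorem integral_eq_sum_tsum_residues {q : ℂ} (hq0 : q ≠ 0) (hq1 : ‖q‖ < 1) {m : ℕ} {e : Fin m → ℂ}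
    (he0 : ∀ j, e j ≠ 0) (hne : ∀ i j, i ≠ j → e i / e j ∉ Omega q) {ρ₀ : ℝ} (hρ₀ : 0 < ρ₀)
    (heρ : ∀ j, ‖e j‖ < ρ₀) {F : ℂ → ℂ}
    (hd : ∀ w, w ≠ 0 → ‖w‖ ≤ ρ₀ → (∀ j (n : ℕ), w ≠ e j * q ^ n) → DifferentiableAt ℂ F w)
    {κ : ℝ} (hκ : κ < 1) (hdecay : ∀ᶠ w in 𝓝[≠] 0, ‖F (w * q)‖ ≤ κ * ‖F w‖)
    {res : Fin m → ℕ → ℂ}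
    (hres : ∀ j n, Tendsto (fun w => (w - e j * q ^ n) * (F w / w)) (𝓝[≠] (e j * q ^ n))
      (𝓝 (res j n)))
    (hsum : ∀ j, Summable (res j)) :
    ∫ ψ in (-Real.pi)..Real.pi, F (ρ₀ * exp (I * ψ)) = 2 * Real.pi * ∑ j, ∑' n, res j n := by
  classical
  have hqpos : 0 < ‖q‖ := norm_pos_iff.2 hq0
  obtain ⟨ρ, hρ, hρlt, hρne⟩ := exists_radius_avoiding q hq0 e hρ₀
  -- The given κ may be negative, while iterating the decay estimate needs a nonnegative ratio.
  set κ' := max κ 0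
  have hκ'1 : κ' < 1 := max_lt hκ one_pos
  have hκ'0 : 0 ≤ κ' := le_max_right _ _
  -- With this choice multiplication by q carries each circle onto the next, so decay under w ↦ wq
  -- compares consecutive circles.
  set r : ℕ → ℝ := fun n => ρ * ‖q‖ ^ n with hr
  have hrpos : ∀ n, 0 < r n := fun n => by positivity
  have hr0 : Tendsto r atTop (𝓝 0) := by
    simpa using (tendsto_pow_atTop_nhds_zero_of_lt_one hqpos.le hq1).const_mul ρ
  have hranti : Antitone r := fun n k hnk =>
    mul_le_mul_of_nonneg_left (pow_le_pow_of_le_one hqpos.le hq1.le hnk) hρ.le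
  have hrle : ∀ n, r n ≤ ρ₀ := fun n => (hranti (Nat.zero_le n)).trans (by simpa [hr] using hρlt.le)
  -- the poles outside the circle of radius `r n`
  have hfin : ∀ n j, {k : ℕ | r n < ‖e j * q ^ k‖}.Finite := by
    intro n j
    have h0 : Tendsto (fun k : ℕ => ‖e j * q ^ k‖) atTop (𝓝 0) := by
      simpa using (tendsto_pow_atTop_nhds_zero_of_lt_one hqpos.le hq1).const_mul ‖e j‖
    have h1 := h0.eventually_le_const (hrpos n)
    rw [← Nat.cofinite_eq_atTop] at h1
    simpa [Filter.eventually_cofinite] using h1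
  set S : ℕ → Fin m → Finset ℕ := fun n j => (hfin n j).toFinset with hS
  -- The finite sets of enclosed poles exhaust ℕ, so the partial residue sums converge by
  -- summability, whatever order the poles are crossed in.
  have hStop : ∀ j, Tendsto (fun n => S n j) atTop atTop := by
    intro j
    refine tendsto_atTop_finset_of_monotone (fun n k hnk x hx => ?_) fun k => ?_
    · simp only [hS, Set.Finite.mem_toFinset, Set.mem_ofPred_eq] at hx ⊢
      exact (hranti hnk).trans_lt hx
    · obtain ⟨n, hn⟩ := (hr0.eventually_lt_const
        (norm_pos_iff.2 (mul_ne_zero (he0 j) (pow_ne_zero k hq0)))).exists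
      exact ⟨n, by simpa [hS] using hn⟩
  have hpole : ∀ j k, ‖e j * q ^ k‖ < ρ₀ := fun j k => by
    rw [norm_mul, norm_pow]
    exact (mul_le_of_le_one_right (norm_nonneg _) (pow_le_one₀ hqpos.le hq1.le)).trans_lt (heρ j)
  have hresidue : ∀ n, (∮ w in C(0, ρ₀), F w / w) - (∮ w in C(0, r n), F w / w)
      = 2 * Real.pi * I * ∑ j, ∑ k ∈ S n j, res j k := by
    intro n
    have hmem : ∀ x : (_ : Fin m) × ℕ, x ∈ Finset.univ.sigma (S n) ↔ r n < ‖e x.1 * q ^ x.2‖ := by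
      intro x
      simp [hS]
    rw [Finset.sum_sigma' Finset.univ (S n) res]
    refine circleIntegral_sub_eq_sum_residues (Finset.univ.sigma (S n))
      (fun x => e x.1 * q ^ x.2) (fun x => res x.1 x.2) (hrpos n) (hrle n)
      (fun x _ y _ hxy => ?_) (fun x hx => ⟨(hmem x).1 hx, hpole x.1 x.2⟩) (fun w => F w / w) ?_
      (fun x _ => hres x.1 x.2)
    · have := mul_pow_injective hq0 hq1 he0 hne (a₁ := (x.1, x.2)) (a₂ := (y.1, y.2)) hxy
      cases x; cases y; simp_all
    · intro w h1 h2 h3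
      have hw0 : w ≠ 0 := norm_pos_iff.1 ((hrpos n).trans_le h1)
      refine (hd w hw0 h2 fun j k hjk => ?_).div differentiableAt_id hw0
      by_cases hk : r n < ‖e j * q ^ k‖
      · exact h3 ⟨j, k⟩ ((hmem ⟨j, k⟩).2 hk) hjk
      · rw [hjk] at h1
        exact hρne j n k (le_antisymm h1 (not_lt.1 hk))
  have hsphere : ∀ n w, ‖w‖ = r n → DifferentiableAt ℂ F w := by
    intro n w hw
    refine hd w (norm_pos_iff.1 (hw ▸ hrpos n)) (hw ▸ hrle n) fun j k hjk => ?_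
    exact hρne j n k (by rw [← hjk, hw])
  obtain ⟨δ, hδ, hδF⟩ : ∃ δ > 0, ∀ w : ℂ, w ≠ 0 → ‖w‖ < δ → ‖F (w * q)‖ ≤ κ' * ‖F w‖ := by
    rw [eventually_nhdsWithin_iff, Metric.eventually_nhds_iff] at hdecay
    obtain ⟨δ, hδ, h⟩ := hdecay
    exact ⟨δ, hδ, fun w hw hwδ => (h (by simpa using hwδ) hw).trans
      (mul_le_mul_of_nonneg_right (le_max_left _ _) (norm_nonneg _))⟩
  obtain ⟨N, hN⟩ := (hr0.eventually_lt_const hδ).exists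
  obtain ⟨M, hM⟩ := (isCompact_sphere (0 : ℂ) (r N)).exists_bound_of_continuousOn (f := F)
    fun w hw => (hsphere N w (by simpa using hw)).continuousAt.continuousWithinAt
  have hbound : ∀ n w, ‖w‖ = r (n + N) → ‖F w‖ ≤ M * κ' ^ n := by
    intro n
    induction n with
    | zero => intro w hw; simpa using hM w (by simpa using hw)
    | succ n ih =>
      intro w hw
      have hwq : ‖w / q‖ = r (n + N) := by
        rw [norm_div, hw, div_eq_iff hqpos.ne']
        simp only [hr]
        ring
      have h1 := hδF (w / q) (norm_pos_iff.1 (hwq ▸ hrpos _))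
        (hwq ▸ (hranti (Nat.le_add_left N n)).trans_lt hN)
      rw [div_mul_cancel₀ _ hq0] at h1
      calc ‖F w‖ ≤ κ' * ‖F (w / q)‖ := h1
        _ ≤ κ' * (M * κ' ^ n) := mul_le_mul_of_nonneg_left (ih _ hwq) hκ'0
        _ = M * κ' ^ (n + 1) := by ring
  have hzero : Tendsto (fun n => ∮ w in C(0, r (n + N)), F w / w) atTop (𝓝 0) := by
    refine squeeze_zero_norm (a := fun n => 2 * Real.pi * (M * κ' ^ n)) (fun n => ?_) ?_
    -- The 1/r coming from 1/w cancels the length 2πr, so only the decaying bound on F remains.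
    · refine (circleIntegral.norm_integral_le_of_norm_le_const (hrpos _).le
        (C := M * κ' ^ n / r (n + N)) fun w hw => ?_).trans_eq ?_
      · have hw' : ‖w‖ = r (n + N) := by simpa using hw
        rw [norm_div, hw']
        exact div_le_div_of_nonneg_right (hbound n w hw') (hrpos _).le
      · have := (hrpos (n + N)).ne'
        field_simp
    · simpa using ((tendsto_pow_atTop_nhds_zero_of_lt_one hκ'0 hκ'1).const_mul M).const_mul
        (2 * Real.pi)
  have hlim1 : Tendsto (fun n => (∮ w in C(0, ρ₀), F w / w) - ∮ w in C(0, r (n + N)), F w / w)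
      atTop (𝓝 (∮ w in C(0, ρ₀), F w / w)) := by
    simpa using hzero.const_sub (∮ w in C(0, ρ₀), F w / w)
  have hlim2 : Tendsto (fun n => 2 * Real.pi * I * ∑ j, ∑ k ∈ S (n + N) j, res j k) atTop
      (𝓝 (2 * Real.pi * I * ∑ j, ∑' k, res j k)) := by
    refine Tendsto.const_mul _ (tendsto_finsetSum _ fun j _ => ?_)
    exact (hsum j).hasSum.comp ((hStop j).comp (tendsto_add_atTop_nat N))
  have h := tendsto_nhds_unique hlim1 (hlim2.congr fun n => (hresidue _).symm)
  rw [circleIntegral_div_eq F hρ₀.ne'] at h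
  apply mul_left_cancel₀ I_ne_zero
  rw [h]
  ring

end GeometricPoles

/-! ### The integrand as a kernel: its residues and its decay at the origin -/

section Kernel

variable {q : ℂ}

lemma pochInfM_add (S T : Multiset ℂ) (q : ℂ) :
    pochInfM (S + T) q = pochInfM S q * pochInfM T q := by
  simp [pochInfM]

lemma smulM_add (b : ℂ) (S T : Multiset ℂ) : smulM b (S + T) = smulM b S + smulM b T := by
  simp [smulM]

lemma pochInfM_smulM (b : ℂ) (S : Multiset ℂ) (q : ℂ) :
    pochInfM (smulM b S) q = (S.map fun x => pochInf (b * x) q).prod := by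
  simp [pochInfM, smulM, Multiset.map_map]

lemma prod_map_ne_zero {ι : Type*} {S : Multiset ι} {g : ι → ℂ} (h : ∀ x ∈ S, g x ≠ 0) :
    (S.map g).prod ≠ 0 := by
  rw [Ne, Multiset.prod_eq_zero_iff, Multiset.mem_map]
  exact fun ⟨x, hx, h0⟩ => h x hx h0

lemma pochInfM_ne_zero (hq1 : ‖q‖ < 1) {S : Multiset ℂ} (hS : ∀ x ∈ S, x ∉ Omega q) :
    pochInfM S q ≠ 0 :=
  prod_map_ne_zero fun x hx => pochInf_ne_zero hq1 (hS x hx)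

lemma differentiable_pochInfM_smulM (hq1 : ‖q‖ < 1) (S : Multiset ℂ) :
    Differentiable ℂ fun w => pochInfM (smulM w S) q := by
  simp only [pochInfM_smulM]
  induction S using Multiset.induction_on with
  | empty => simp
  | cons x S ih =>
    simp only [Multiset.map_cons, Multiset.prod_cons]
    exact ((differentiable_pochInf hq1).comp (differentiable_id.mul_const x)).mul ih

lemma pochInfM_smulM_eq_mul (hq1 : ‖q‖ < 1) (w : ℂ) (S : Multiset ℂ) :
    pochInfM (smulM w S) q
      = (S.map fun x => 1 - w * x).prod * pochInfM (smulM (w * q) S) q := by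
  simp only [pochInfM_smulM]
  rw [← Multiset.prod_map_mul]
  congr 1
  refine Multiset.map_congr rfl fun x _ => ?_
  rw [pochInf_eq_one_sub_mul hq1]
  ring_nf

lemma params_eq_cons_paramsErase {m : ℕ} (e : Fin m → ℂ) (j : Fin m) :
    params e = e j ::ₘ paramsErase e j := by
  rw [params, paramsErase, ← Multiset.map_cons e]
  congr 1
  rw [Finset.erase_val, Multiset.cons_erase (Finset.mem_univ_val j)]

lemma mem_params {m : ℕ} {e : Fin m → ℂ} {x : ℂ} : x ∈ params e ↔ ∃ j, e j = x := by
  simp [params]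

lemma mem_paramsErase {m : ℕ} {e : Fin m → ℂ} {j : Fin m} {x : ℂ} :
    x ∈ paramsErase e j ↔ ∃ i, i ≠ j ∧ e i = x := by
  simp only [paramsErase, Multiset.mem_map, Finset.mem_val, Finset.mem_erase, Finset.mem_univ,
    and_true]

lemma pochInfM_smulM_params {m : ℕ} (b : ℂ) (e : Fin m → ℂ) (j : Fin m) (q : ℂ) :
    pochInfM (smulM b (params e)) q
      = pochInf (b * e j) q * pochInfM (smulM b (paramsErase e j)) q := by
  rw [params_eq_cons_paramsErase e j]
  simp [pochInfM, smulM]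

/-- The function `(P w, Q / w; q)_∞ / (R w, S / w; q)_∞`. -/
def kernel (P Q R S : Multiset ℂ) (q w : ℂ) : ℂ :=
  pochInfM (smulM w P) q * pochInfM (smulM w⁻¹ Q) q
    / (pochInfM (smulM w R) q * pochInfM (smulM w⁻¹ S) q)

/-- The residue of `kernel P Q R (params e) q w / w` at `w = e j * q ^ n`. -/
def kernelResidue {m : ℕ} (P Q R : Multiset ℂ) (e : Fin m → ℂ) (q : ℂ) (j : Fin m) (n : ℕ) : ℂ :=
  pochInfM (smulM (e j * q ^ n) P) q * pochInfM (smulM (e j * q ^ n)⁻¹ Q) q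
    / (pochInfM (smulM (e j * q ^ n) R) q * (pochInfM (smulM (e j * q ^ n)⁻¹ (paramsErase e j)) q
      * (poch (q ^ n)⁻¹ q n * pochInf q q)))

lemma differentiableAt_pochInfM_smulM_inv (hq1 : ‖q‖ < 1) (S : Multiset ℂ) {w : ℂ} (hw : w ≠ 0) :
    DifferentiableAt ℂ (fun w => pochInfM (smulM w⁻¹ S) q) w :=
  (differentiable_pochInfM_smulM hq1 S _).comp w (differentiableAt_inv hw)

lemma differentiableAt_kernel (hq1 : ‖q‖ < 1) (P Q : Multiset ℂ) {R S : Multiset ℂ} {w : ℂ}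
    (hw : w ≠ 0) (hR : ∀ x ∈ R, w * x ∉ Omega q) (hS : ∀ x ∈ S, w⁻¹ * x ∉ Omega q) :
    DifferentiableAt ℂ (kernel P Q R S q) w := by
  refine DifferentiableAt.div
    ((differentiable_pochInfM_smulM hq1 P w).mul (differentiableAt_pochInfM_smulM_inv hq1 Q hw))
    ((differentiable_pochInfM_smulM hq1 R w).mul (differentiableAt_pochInfM_smulM_inv hq1 S hw))
    (mul_ne_zero (pochInfM_ne_zero hq1 ?_) (pochInfM_ne_zero hq1 ?_))
  · simpa [smulM] using hR
  · simpa [smulM] using hS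

/-- Locates the zeros of (x/w;q)_∞ at the points w = xq^n. -/
lemma inv_mul_mem_Omega_iff (hq0 : q ≠ 0) {w x : ℂ} (hw : w ≠ 0) :
    w⁻¹ * x ∈ Omega q ↔ ∃ n : ℕ, w = x * q ^ n := by
  refine exists_congr fun n => ?_
  have := pow_ne_zero n hq0
  constructor
  · intro h
    have h' : w * (w⁻¹ * x) * q ^ n = w * ((q ^ n)⁻¹ * q ^ n) := by rw [h]; ring
    rw [mul_inv_cancel_left₀ hw, inv_mul_cancel₀ this, mul_one] at h'
    exact h'.symm
  · intro h
    have hx : x ≠ 0 := by rintro rfl; simp at h; exact hw h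
    rw [h]
    field_simp

lemma poch_inv_pow_ne_zero (hq0 : q ≠ 0) (hq1 : ‖q‖ < 1) (n : ℕ) : poch (q ^ n)⁻¹ q n ≠ 0 := by
  refine Finset.prod_ne_zero_iff.2 fun k hk h => ?_
  have hqn := pow_ne_zero n hq0
  have h' : q ^ n = q ^ k := by
    rw [sub_eq_zero, eq_comm, inv_mul_eq_iff_eq_mul₀ hqn, mul_one] at h
    exact h.symm
  exact (Finset.mem_range.1 hk).ne' (pow_left_injective_of_norm_lt_one hq0 hq1 h')

/-- Of all factors in the denominator only 1 - e_j q^n/w = (w - p)/w vanishes at p = e_j q^n. It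
cancels against w - p and the 1/w, leaving a function continuous at p. -/
lemma tendsto_kernelResidue (hq0 : q ≠ 0) (hq1 : ‖q‖ < 1) (P Q : Multiset ℂ) {R : Multiset ℂ}
    {m : ℕ} {e : Fin m → ℂ} (he0 : ∀ j, e j ≠ 0) (hne : ∀ i j, i ≠ j → e i / e j ∉ Omega q)
    (j : Fin m) (n : ℕ) (hR : ∀ x ∈ R, e j * q ^ n * x ∉ Omega q) :
    Tendsto (fun w => (w - e j * q ^ n) * (kernel P Q R (params e) q w / w)) (𝓝[≠] (e j * q ^ n))
      (𝓝 (kernelResidue P Q R e q j n)) := by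
  set p := e j * q ^ n with hp
  have hqn := pow_ne_zero n hq0
  have hej := he0 j
  have hp0 : p ≠ 0 := mul_ne_zero hej hqn
  -- The kernel with the vanishing factor deleted: (e_j/w;q)_∞ is split into its first n factors and
  -- those from index n + 1 on.
  set G : ℂ → ℂ := fun w => pochInfM (smulM w P) q * pochInfM (smulM w⁻¹ Q) q
    / (pochInfM (smulM w R) q * (pochInfM (smulM w⁻¹ (paramsErase e j)) q
      * (poch (w⁻¹ * e j) q n * pochInf (w⁻¹ * e j * q ^ (n + 1)) q))) with hG
  have hpe : p⁻¹ * e j = (q ^ n)⁻¹ := by rw [hp]; field_simp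
  have hpe' : p⁻¹ * e j * q ^ (n + 1) = q := by rw [hpe, pow_succ]; field_simp
  have hGp : G p = kernelResidue P Q R e q j n := by
    simp only [hG, hpe, kernelResidue, ← hp]
    rw [← hpe, hpe']
  have hc1 : ContinuousAt (fun w => poch (w⁻¹ * e j) q n) p := by
    unfold poch
    fun_prop (disch := assumption)
  have hc2 : ContinuousAt (fun w => pochInf (w⁻¹ * e j * q ^ (n + 1)) q) p := by
    refine ContinuousAt.comp (g := fun a => pochInf a q)
      (differentiable_pochInf hq1).continuous.continuousAt ?_
    fun_prop (disch := assumption)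
  have hGc : ContinuousAt G p := by
    refine ContinuousAt.div ((differentiable_pochInfM_smulM hq1 P p).continuousAt.mul
      (differentiableAt_pochInfM_smulM_inv hq1 Q hp0).continuousAt)
      ((differentiable_pochInfM_smulM hq1 R p).continuousAt.mul
      ((differentiableAt_pochInfM_smulM_inv hq1 _ hp0).continuousAt.mul (hc1.mul hc2))) ?_
    rw [hpe', hpe]
    refine mul_ne_zero (pochInfM_ne_zero hq1 (by simpa [smulM] using hR))
      (mul_ne_zero (pochInfM_ne_zero hq1 ?_) (mul_ne_zero (poch_inv_pow_ne_zero hq0 hq1 n)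
      (pochInf_ne_zero hq1 (notMem_Omega_of_norm_lt_one hq0 hq1 hq1))))
    simp only [smulM, Multiset.mem_map, mem_paramsErase]
    rintro x ⟨_, ⟨i, hij, rfl⟩, rfl⟩ hx
    obtain ⟨k, hk⟩ := (inv_mul_mem_Omega_iff hq0 hp0).1 hx
    have := mul_pow_injective hq0 hq1 he0 hne (a₁ := (j, n)) (a₂ := (i, k)) hk
    exact hij (congrArg Prod.fst this).symm
  rw [← hGp]
  refine (hGc.tendsto.mono_left nhdsWithin_le_nhds).congr' ?_
  filter_upwards [nhdsWithin_le_nhds (eventually_ne_nhds hp0), self_mem_nhdsWithin] with w hw hwp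
  have hwp' : w - p ≠ 0 := sub_ne_zero.2 hwp
  have hfac : pochInf (w⁻¹ * e j) q
      = poch (w⁻¹ * e j) q n * pochInf (w⁻¹ * e j * q ^ (n + 1)) q * ((w - p) / w) := by
    rw [pochInf_eq_poch_mul hq1 _ (n + 1), poch_succ]
    have : 1 - w⁻¹ * e j * q ^ n = (w - p) / w := by rw [hp]; field_simp
    rw [this]
    ring
  simp only [hG, kernel]
  rw [pochInfM_smulM_params _ e j, hfac]
  have hone : (w - p) / w ≠ 0 := div_ne_zero hwp' hw
  rw [show ∀ N D : ℂ, (w - p) * (N / D / w) = (N * ((w - p) / w)) / D by intros; ring,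
    show ∀ a b c d t : ℂ, a * (b * c * t * d) = (a * (d * (b * c))) * t by intros; ring,
    mul_div_mul_right _ _ hone]

/-- Each product in w loses its first factor and each product in 1/w gains one. Vanishing factors
from S are harmless, since both sides then equal 0 by the convention for division by zero. -/
lemma kernel_mul (hq0 : q ≠ 0) (hq1 : ‖q‖ < 1) (P Q R S : Multiset ℂ) {w : ℂ}
    (hP : ∀ x ∈ P, 1 - w * x ≠ 0) (hR : ∀ x ∈ R, 1 - w * x ≠ 0) :
    kernel P Q R S q (w * q)
      = ((R.map fun x => 1 - w * x).prod / (P.map fun x => 1 - w * x).prod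
        * ((Q.map fun x => 1 - (w * q)⁻¹ * x).prod / (S.map fun x => 1 - (w * q)⁻¹ * x).prod))
        * kernel P Q R S q w := by
  have hinv : (w * q)⁻¹ * q = w⁻¹ := by
    rw [mul_inv, mul_assoc, inv_mul_cancel₀ hq0, mul_one]
  have hP' : (P.map fun x => 1 - w * x).prod ≠ 0 := prod_map_ne_zero hP
  have hR' : (R.map fun x => 1 - w * x).prod ≠ 0 := prod_map_ne_zero hR
  unfold kernel
  rw [pochInfM_smulM_eq_mul hq1 w P, pochInfM_smulM_eq_mul hq1 w R,
    pochInfM_smulM_eq_mul hq1 (w * q)⁻¹ Q, pochInfM_smulM_eq_mul hq1 (w * q)⁻¹ S, hinv]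
  simp only [div_eq_mul_inv, mul_inv]
  field_simp

lemma tendsto_prod_one_sub_mul (S : Multiset ℂ) :
    Tendsto (fun w : ℂ => (S.map fun x => 1 - w * x).prod) (𝓝 0) (𝓝 1) := by
  have h := tendsto_multiset_prod (x := 𝓝 (0 : ℂ)) S (f := fun x w => 1 - w * x)
    (a := fun x => 1 - 0 * x) fun x _ => Continuous.tendsto (by fun_prop) 0
  simpa using h

lemma prod_one_sub_inv_mul (S : Multiset ℂ) {w : ℂ} (hw : w ≠ 0) :
    (S.map fun x => 1 - w⁻¹ * x).prod * w ^ Multiset.card S = (S.map fun x => w - x).prod := by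
  induction S using Multiset.induction_on with
  | empty => simp
  | cons x S ih =>
    simp only [Multiset.map_cons, Multiset.prod_cons, Multiset.card_cons, ← ih]
    rw [pow_succ]
    linear_combination -(Multiset.map (fun x => 1 - w⁻¹ * x) S).prod * w ^ Multiset.card S * x
      * mul_inv_cancel₀ hw

lemma tendsto_prod_sub (S : Multiset ℂ) :
    Tendsto (fun w : ℂ => (S.map fun x => w - x).prod) (𝓝 0) (𝓝 (S.map fun x => -x).prod) := by
  have h := tendsto_multiset_prod (x := 𝓝 (0 : ℂ)) S (f := fun x w => w - x)
    (a := fun x => 0 - x) fun x _ => Continuous.tendsto (by fun_prop) 0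
  simpa using h

lemma norm_prod_map_neg (S : Multiset ℂ) : ‖(S.map fun x => -x).prod‖ = ‖S.prod‖ := by
  induction S using Multiset.induction_on with
  | empty => simp
  | cons x S ih => simp only [Multiset.map_cons, Multiset.prod_cons, norm_mul, norm_neg, ih]

/-- Clearing the powers of 1/w turns the quotient into w^{|S|-|Q|} times a quotient of polynomials
with nonzero denominator at 0. The convention 0^0 = 1 covers the balanced case |S| = |Q| in the same
formula. -/
lemma tendsto_prod_div_prod {Q S : Multiset ℂ} (hcard : Multiset.card Q ≤ Multiset.card S)
    (hS : ∀ x ∈ S, x ≠ 0) :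
    Tendsto (fun w : ℂ => (Q.map fun x => 1 - w⁻¹ * x).prod / (S.map fun x => 1 - w⁻¹ * x).prod)
      (𝓝[≠] 0) (𝓝 (0 ^ (Multiset.card S - Multiset.card Q)
        * ((Q.map fun x => -x).prod / (S.map fun x => -x).prod))) := by
  have hS' : (S.map fun x => -x).prod ≠ 0 :=
    prod_map_ne_zero fun x hx => neg_ne_zero.2 (hS x hx)
  have h : Tendsto (fun w : ℂ => w ^ (Multiset.card S - Multiset.card Q)
      * ((Q.map fun x => w - x).prod / (S.map fun x => w - x).prod)) (𝓝 0) (𝓝 _) :=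
    ((continuous_pow _).tendsto 0).mul ((tendsto_prod_sub Q).div (tendsto_prod_sub S) hS')
  refine (h.mono_left nhdsWithin_le_nhds).congr' ?_
  filter_upwards [self_mem_nhdsWithin] with w hw
  have hw0 : w ≠ 0 := hw
  rw [← prod_one_sub_inv_mul Q hw0, ← prod_one_sub_inv_mul S hw0]
  obtain ⟨k, hk⟩ := Nat.exists_eq_add_of_le hcard
  rw [hk, Nat.add_sub_cancel_left, pow_add]
  field_simp

/-- The multiplier in `kernel_mul` converges to a limit L of modulus below 1, and any κ strictly
between |L| and 1 serves near the origin. -/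
lemma exists_kernel_decay (hq0 : q ≠ 0) (hq1 : ‖q‖ < 1) (P R : Multiset ℂ) {Q S : Multiset ℂ}
    (hcard : Multiset.card Q ≤ Multiset.card S) (hS : ∀ x ∈ S, x ≠ 0)
    (hprod : Multiset.card Q = Multiset.card S → ‖Q.prod‖ < ‖S.prod‖) :
    ∃ κ < 1, ∀ᶠ w in 𝓝[≠] (0 : ℂ),
      ‖kernel P Q R S q (w * q)‖ ≤ κ * ‖kernel P Q R S q w‖ := by
  set L : ℂ := 0 ^ (Multiset.card S - Multiset.card Q)
        * ((Q.map fun x => -x).prod / (S.map fun x => -x).prod) with hL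
  have hL1 : ‖L‖ < 1 := by
    rcases hcard.eq_or_lt with h | h
    · have hpos : 0 < ‖S.prod‖ := (norm_nonneg _).trans_lt (hprod h)
      rw [hL, h, Nat.sub_self, pow_zero, one_mul, norm_div, norm_prod_map_neg, norm_prod_map_neg,
        div_lt_one hpos]
      exact hprod h
    · rw [hL, zero_pow (Nat.sub_pos_of_lt h).ne', zero_mul, norm_zero]
      exact one_pos
  obtain ⟨κ, hκ, hκ1⟩ := exists_between hL1
  refine ⟨κ, hκ1, ?_⟩
  have hwq : Tendsto (fun w : ℂ => w * q) (𝓝[≠] 0) (𝓝[≠] 0) := by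
    refine tendsto_nhdsWithin_iff.2 ⟨?_, eventually_nhdsWithin_of_forall fun w hw =>
      mul_ne_zero hw hq0⟩
    have : Tendsto (fun w : ℂ => w * q) (𝓝 0) (𝓝 (0 * q)) := Continuous.tendsto (by fun_prop) 0
    rw [zero_mul] at this
    exact this.mono_left nhdsWithin_le_nhds
  have h1 : Tendsto (fun w : ℂ => (R.map fun x => 1 - w * x).prod
      / (P.map fun x => 1 - w * x).prod) (𝓝[≠] 0) (𝓝 (1 / 1)) :=
    ((tendsto_prod_one_sub_mul R).div (tendsto_prod_one_sub_mul P) one_ne_zero).mono_left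
      nhdsWithin_le_nhds
  have h2 := (h1.mul ((tendsto_prod_div_prod hcard hS).comp hwq)).norm
  rw [div_one, one_mul] at h2
  have hne : ∀ T : Multiset ℂ, ∀ᶠ w in 𝓝[≠] (0 : ℂ), ∀ x ∈ T, 1 - w * x ≠ 0 := by
    intro T
    have := (tendsto_prod_one_sub_mul T).eventually_ne one_ne_zero
    filter_upwards [nhdsWithin_le_nhds this] with w hw x hx h0
    exact hw (Multiset.prod_eq_zero (Multiset.mem_map.2 ⟨x, hx, h0⟩))
  filter_upwards [h2.eventually_le_const hκ, hne P, hne R] with w hw hP hR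
  rw [kernel_mul hq0 hq1 P Q R S hP hR, norm_mul]
  exact mul_le_mul_of_nonneg_right hw (norm_nonneg _)

/-- The circle integral of `kernel` as a sum over its poles inside the circle. -/
theorem integral_kernel (hq0 : q ≠ 0) (hq1 : ‖q‖ < 1) (P : Multiset ℂ) {Q R : Multiset ℂ}
    {m : ℕ} {e : Fin m → ℂ} (he0 : ∀ j, e j ≠ 0) (hne : ∀ i j, i ≠ j → e i / e j ∉ Omega q)
    {ρ₀ : ℝ} (hρ₀ : 0 < ρ₀) (heρ : ∀ j, ‖e j‖ < ρ₀) (hR : ∀ x ∈ R, ‖x‖ * ρ₀ < 1)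
    (hcard : Multiset.card Q ≤ m) (hprod : Multiset.card Q = m → ‖Q.prod‖ < ‖∏ j, e j‖)
    (hsum : ∀ j, Summable (kernelResidue P Q R e q j)) :
    ∫ ψ in (-Real.pi)..Real.pi, kernel P Q R (params e) q (ρ₀ * Complex.exp (Complex.I * ψ))
      = 2 * Real.pi * ∑ j, ∑' n, kernelResidue P Q R e q j n := by
  have hRw : ∀ w : ℂ, ‖w‖ ≤ ρ₀ → ∀ x ∈ R, w * x ∉ Omega q := fun w hw x hx => by
    refine notMem_Omega_of_norm_lt_one hq0 hq1 ?_
    rw [norm_mul, mul_comm]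
    exact (mul_le_mul_of_nonneg_left hw (norm_nonneg _)).trans_lt (hR x hx)
  have hcardS : Multiset.card (params e) = m := by simp [params]
  have hprodS : (params e).prod = ∏ j, e j := rfl
  obtain ⟨κ, hκ, hdecay⟩ := exists_kernel_decay hq0 hq1 P R (Q := Q) (S := params e)
    (by rwa [hcardS]) (by simpa [mem_params] using he0) (by rwa [hcardS, hprodS])
  refine integral_eq_sum_tsum_residues hq0 hq1 he0 hne hρ₀ heρ (fun w hw hwρ hpole => ?_) hκ hdecay
    (fun j n => tendsto_kernelResidue hq0 hq1 P Q he0 hne j n (hRw _ ?_)) hsum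
  · refine differentiableAt_kernel hq1 P Q hw (hRw w hwρ) fun x hx => ?_
    obtain ⟨j, rfl⟩ := mem_params.1 hx
    rw [inv_mul_mem_Omega_iff hq0 hw]
    exact fun ⟨n, hn⟩ => hpole j n hn
  · rw [norm_mul, norm_pow]
    exact (mul_le_of_le_one_right (norm_nonneg _)
      (pow_le_one₀ (norm_nonneg q) hq1.le)).trans (heρ j).le

end Kernel

/-! ### Convergence of basic hypergeometric series -/

section Series

variable {q : ℂ}

lemma pochM_add (S T : Multiset ℂ) (q : ℂ) (n : ℕ) :
    pochM (S + T) q n = pochM S q n * pochM T q n := by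
  simp [pochM]

lemma pochM_replicate_zero (l : ℕ) (q : ℂ) (n : ℕ) : pochM (Multiset.replicate l 0) q n = 1 := by
  simp [pochM, poch]

lemma pochM_ne_zero {S : Multiset ℂ} (hS : ∀ x ∈ S, x ∉ Omega q) (n : ℕ) : pochM S q n ≠ 0 :=
  prod_map_ne_zero fun x hx => poch_ne_zero (hS x hx) n

lemma tendsto_pochM (hq1 : ‖q‖ < 1) (S : Multiset ℂ) :
    Tendsto (pochM S q) atTop (𝓝 (pochInfM S q)) :=
  tendsto_multiset_prod S fun x _ => tendsto_poch hq1 x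

lemma pochInfM_smulM_eq_pochM_mul (hq1 : ‖q‖ < 1) (b : ℂ) (S : Multiset ℂ) (n : ℕ) :
    pochInfM (smulM b S) q = pochM (smulM b S) q n * pochInfM (smulM (b * q ^ n) S) q := by
  rw [pochInfM_smulM, pochInfM_smulM]
  simp only [pochM, smulM, Multiset.map_map, Function.comp_def]
  rw [← Multiset.prod_map_mul]
  congr 1
  refine Multiset.map_congr rfl fun x _ => ?_
  rw [pochInf_eq_poch_mul hq1 _ n]
  ring_nf

lemma pochInfM_smulM_mul_pow (hq1 : ‖q‖ < 1) {b : ℂ} {S : Multiset ℂ}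
    (hS : ∀ x ∈ S, b * x ∉ Omega q) (n : ℕ) :
    pochInfM (smulM (b * q ^ n) S) q = pochInfM (smulM b S) q / pochM (smulM b S) q n := by
  rw [eq_div_iff (pochM_ne_zero (by simpa [smulM] using hS) n),
    pochInfM_smulM_eq_pochM_mul hq1 b S n, mul_comm]

/-- Reversal of the n extra factors, parameter by parameter; it produces the numerator and
denominator parameters of the form q c_k/x in J. -/
lemma pochInfM_smulM_inv_mul_pow (hq0 : q ≠ 0) (hq1 : ‖q‖ < 1) {b : ℂ} (hb : b ≠ 0)
    {S : Multiset ℂ} (hS : ∀ x ∈ S, x ≠ 0) (n : ℕ) :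
    pochInfM (smulM (b * q ^ n)⁻¹ S) q = pochInfM (divM S b) q * (pochM (divByM (q * b) S) q n
      * (S.prod ^ n * (((-1) ^ n * q ^ n.choose 2 * q ^ n * b ^ n)⁻¹) ^ Multiset.card S)) := by
  induction S using Multiset.induction_on with
  | empty => simp [pochInfM, smulM, divM, divByM, pochM]
  | cons x S ih =>
    have hx : x ≠ 0 := hS x (Multiset.mem_cons_self x S)
    have ih' := ih fun y hy => hS y (Multiset.mem_cons_of_mem hy)
    have h := pochInf_mul_inv_pow hq0 hq1 (div_ne_zero hx hb) n
    rw [show x / b * (q ^ n)⁻¹ = (b * q ^ n)⁻¹ * x by rw [mul_inv, div_eq_mul_inv]; ring,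
      show q / (x / b) = q * b / x by field_simp] at h
    simp only [pochInfM, smulM, divM, divByM, pochM, Multiset.map_cons, Multiset.prod_cons,
      Multiset.card_cons] at ih' h ⊢
    rw [ih', h, div_pow, mul_pow x, pow_succ _ (Multiset.card S)]
    simp only [mul_inv, div_eq_mul_inv]
    ring

/-- The quotient converges to one of infinite products with nonzero denominator, hence is bounded.
Convergence of the series thus depends only on the powers of q and z. -/
lemma exists_norm_pochM_div_le (hq0 : q ≠ 0) (hq1 : ‖q‖ < 1) (as : Multiset ℂ) {bs : Multiset ℂ}
    (hbs : ∀ x ∈ bs, x ∉ Omega q) :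
    ∃ M, ∀ n, ‖pochM as q n / (poch q q n * pochM bs q n)‖ ≤ M := by
  have h : Tendsto (fun n => pochM as q n / (poch q q n * pochM bs q n)) atTop (𝓝 _) :=
    (tendsto_pochM hq1 as).div ((tendsto_poch hq1 q).mul (tendsto_pochM hq1 bs))
      (mul_ne_zero (pochInf_ne_zero hq1 (notMem_Omega_of_norm_lt_one hq0 hq1 hq1))
        (pochInfM_ne_zero hq1 hbs))
  obtain ⟨M, hM⟩ := h.norm.bddAbove_range
  exact ⟨M, fun n => hM ⟨n, rfl⟩⟩

lemma summable_pochM_div_mul (hq0 : q ≠ 0) (hq1 : ‖q‖ < 1) (as : Multiset ℂ) {bs : Multiset ℂ}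
    (hbs : ∀ x ∈ bs, x ∉ Omega q) {u : ℕ → ℂ} (hu : Summable fun n => ‖u n‖) :
    Summable fun n => ‖pochM as q n / (poch q q n * pochM bs q n) * u n‖ := by
  obtain ⟨M, hM⟩ := exists_norm_pochM_div_le hq0 hq1 as hbs
  refine (hu.mul_left M).of_nonneg_of_le (fun n => norm_nonneg _) fun n => ?_
  rw [norm_mul]
  exact mul_le_mul_of_nonneg_right (hM n) (norm_nonneg _)

/-- Ratio test: consecutive terms have ratio |q|^{sn}|z|, which tends to 0 unless s = 0. -/
lemma summable_pow_choose_two_pow_mul_pow (hq1 : ‖q‖ < 1) (s : ℕ) {z : ℂ}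
    (hz : s = 0 → ‖z‖ < 1) :
    Summable fun n : ℕ => ‖((-1) ^ n * q ^ n.choose 2) ^ s * z ^ n‖ := by
  have hlim : Tendsto (fun n : ℕ => (‖q‖ ^ s) ^ n * ‖z‖) atTop
      (𝓝 (if s = 0 then ‖z‖ else 0)) := by
    split_ifs with h
    · simp [h]
    · simpa using (tendsto_pow_atTop_nhds_zero_of_lt_one (by positivity)
        (pow_lt_one₀ (norm_nonneg q) hq1 h)).mul_const ‖z‖
  have hlt : (if s = 0 then ‖z‖ else 0) < 1 := by
    split_ifs with h
    · exact hz h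
    · exact one_pos
  obtain ⟨r, hr, hr1⟩ := exists_between hlt
  refine summable_of_ratio_norm_eventually_le hr1 ?_
  filter_upwards [hlim.eventually_le_const hr] with n hn
  simp only [norm_norm, norm_mul, norm_pow, norm_neg, norm_one, one_pow, one_mul]
  rw [Nat.choose_succ_succ' n 1, Nat.choose_one_right]
  calc (‖q‖ ^ (n + n.choose 2)) ^ s * ‖z‖ ^ (n + 1)
      = ((‖q‖ ^ s) ^ n * ‖z‖) * ((‖q‖ ^ n.choose 2) ^ s * ‖z‖ ^ n) := by
        rw [pow_add, mul_pow, ← pow_mul, ← pow_mul ‖q‖ s n, mul_comm s n]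
        ring
    _ ≤ r * _ := mul_le_mul_of_nonneg_right hn (by positivity)

lemma phiTerm_eq_of_card {as bs : Multiset ℂ} {s : ℕ}
    (hs : Multiset.card as + s = Multiset.card bs + 1) (q z : ℂ) (n : ℕ) :
    phiTerm as bs q z n = pochM as q n / (poch q q n * pochM bs q n)
      * (((-1) ^ n * q ^ n.choose 2) ^ s * z ^ n) := by
  have h : (Multiset.card bs : ℤ) + 1 - (Multiset.card as : ℤ) = (s : ℕ) := by omega
  rw [phiTerm, h, zpow_natCast, mul_assoc]

lemma summable_norm_phiTerm (hq0 : q ≠ 0) (hq1 : ‖q‖ < 1) {as bs : Multiset ℂ} {s : ℕ}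
    (hs : Multiset.card as + s = Multiset.card bs + 1) (hbs : ∀ x ∈ bs, x ∉ Omega q) {z : ℂ}
    (hz : s = 0 → ‖z‖ < 1) : Summable fun n => ‖phiTerm as bs q z n‖ := by
  simp only [phiTerm_eq_of_card hs]
  exact summable_pochM_div_mul hq0 hq1 as hbs (summable_pow_choose_two_pow_mul_pow hq1 s hz)

/-- The series `_{r+1}φ_s` with `s > r` is an entire function of its argument. -/
lemma differentiable_phi (hq0 : q ≠ 0) (hq1 : ‖q‖ < 1) {as bs : Multiset ℂ} {s : ℕ}
    (hs : Multiset.card as + s = Multiset.card bs + 1) (hs0 : s ≠ 0)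
    (hbs : ∀ x ∈ bs, x ∉ Omega q) : Differentiable ℂ (phi as bs q) := by
  intro z
  have h : DifferentiableOn ℂ (fun w => ∑' n, phiTerm as bs q w n) (Metric.ball 0 (‖z‖ + 1)) := by
    -- On the ball of radius |z| + 1 the terms are dominated by the norms of those at the point |z|
    -- + 1.
    refine Complex.differentiableOn_tsum_of_summable_norm
      (summable_norm_phiTerm hq0 hq1 hs hbs (z := ((‖z‖ + 1 : ℝ) : ℂ)) fun h => absurd h hs0)
      (fun n => ?_) Metric.isOpen_ball fun n w hw => ?_
    · unfold phiTerm
      fun_prop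
    · unfold phiTerm
      rw [norm_mul _ (w ^ n), norm_mul _ (_ ^ n), norm_pow, norm_pow, Complex.norm_real,
        Real.norm_of_nonneg (by positivity)]
      exact mul_le_mul_of_nonneg_left (pow_le_pow_left₀ (norm_nonneg w)
        (mem_ball_zero_iff.1 hw).le n) (norm_nonneg _)
  exact h.differentiableAt (Metric.isOpen_ball.mem_nhds (by simp))

/-- Padding with zeros so as to balance the numbers of parameters removes the quadratic powers of
`q` from the terms. -/
lemma phiZTerm_eq_of_card {m : ℤ} {as bs : Multiset ℂ}
    (hm : m = Multiset.card as - Multiset.card bs - 1) (q z : ℂ) (n : ℕ) :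
    phiZTerm m as bs q z n = pochM as q n / (poch q q n * pochM bs q n) * z ^ n := by
  rw [phiZTerm, phiTerm_eq_of_card (s := 0), pochM_add, pochM_add, pochM_replicate_zero,
    pochM_replicate_zero]
  · simp
  · simp only [Multiset.card_add, Multiset.card_replicate]
    omega

end Series

/-! ### Residues as terms of the series in H and J -/

section Terms

variable {q : ℂ} {A C : ℕ}

lemma hTerm_eq (a : Fin A → ℂ) (c : Fin C → ℂ) (d d' q : ℂ) (n : ℕ) :
    hTerm a c d d' q n = pochM (smulM d (params c)) q n
      / (poch q q n * (pochM (smulM d (params a)) q n * poch (q * d / d') q n)) * q ^ n := by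
  rw [hTerm, phiZTerm_eq_of_card, pochM_add]
  · simp [pochM]
  · simp only [smulM, params, Multiset.card_map, Multiset.card_add, Multiset.card_singleton,
      Finset.card_val, Finset.card_univ, Fintype.card_fin]
    push_cast
    ring

lemma summable_hTerm (hq0 : q ≠ 0) (hq1 : ‖q‖ < 1) {a : Fin A → ℂ} (c : Fin C → ℂ) {d d' : ℂ}
    (hd : d / d' ∉ Omega q) (ha : ∀ i, d * a i ∉ Omega q) : Summable (hTerm a c d d' q) := by
  have hbs : ∀ x ∈ smulM d (params a) + {q * d / d'}, x ∉ Omega q := by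
    intro x hx
    rcases Multiset.mem_add.1 hx with hx | hx
    · simp only [smulM, Multiset.mem_map, mem_params] at hx
      obtain ⟨_, ⟨i, rfl⟩, rfl⟩ := hx
      exact ha i
    · rw [Multiset.mem_singleton.1 hx, mul_div_assoc]
      exact mul_notMem_Omega hq0 hd
  have h := (summable_pochM_div_mul hq0 hq1 (smulM d (params c)) hbs (u := fun n => q ^ n)
    (by simpa using summable_geometric_of_lt_one (norm_nonneg q) hq1)).of_norm
  refine h.congr fun n => ?_
  rw [hTerm_eq, pochM_add]
  simp [pochM]

lemma poch_inv_pow_eq (hq0 : q ≠ 0) (n : ℕ) :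
    poch (q ^ n)⁻¹ q n = poch q q n * (((-1) ^ n * q ^ n.choose 2)⁻¹ * (q ^ n)⁻¹) := by
  simpa using poch_mul_inv_pow hq0 one_ne_zero n

/-- The theta arguments x and y are kept abstract because f and f d₁/d₂ exchange places between the
two progressions; only y/x = d'/d matters. -/
lemma residue_eq_hTerm (hq0 : q ≠ 0) (hq1 : ‖q‖ < 1) {a : Fin A → ℂ} {c : Fin C → ℂ}
    {d d' x y : ℂ} (hd : d ≠ 0) (hd' : d' ≠ 0) (hx : x ≠ 0) (hy : y ≠ 0) (hxy : y / x = d' / d)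
    (ha : ∀ i, d * a i ∉ Omega q) (hc : ∀ k, d * c k ∉ Omega q) (n : ℕ) :
    theta (x * q ^ n) q * theta (y * (q ^ n)⁻¹) q * pochInfM (smulM (d * q ^ n) (params a)) q
      / (pochInfM (smulM (d * q ^ n) (params c)) q
        * (pochInf ((d * q ^ n)⁻¹ * d') q * (poch (q ^ n)⁻¹ q n * pochInf q q)))
      = theta x q * theta y q / pochInf q q * (pochInfM (smulM d (params a)) q
        / (pochInf (d' / d) q * pochInfM (smulM d (params c)) q)) * hTerm a c d d' q n := by
  have hdd : d' / d ≠ 0 := div_ne_zero hd' hd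
  have h1 : (d * q ^ n)⁻¹ * d' = d' / d * (q ^ n)⁻¹ := by rw [mul_inv, div_eq_mul_inv]; ring
  have h2 : q / (d' / d) = q * d / d' := by field_simp
  have hmem : ∀ {l : ℕ} {b : Fin l → ℂ}, (∀ i, d * b i ∉ Omega q) →
      ∀ x ∈ params b, d * x ∉ Omega q := by
    intro l b hb x hx
    obtain ⟨i, rfl⟩ := mem_params.1 hx
    exact hb i
  rw [theta_mul_pow_mul_theta_mul_inv_pow hq0 hq1 hx hy, hxy, h1, pochInf_mul_inv_pow hq0 hq1 hdd,
    h2, poch_inv_pow_eq hq0, pochInfM_smulM_mul_pow hq1 (hmem ha), pochInfM_smulM_mul_pow hq1 (hmem hc),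
    hTerm_eq]
  have hqn := pow_ne_zero n hq0
  have hqc := pow_ne_zero (n.choose 2) hq0
  have hddn := pow_ne_zero n hdd
  have hsq : ((-1 : ℂ) ^ n) * (-1) ^ n = 1 := by rw [← mul_pow]; simp
  have hm : ((-1 : ℂ)) ^ n ≠ 0 := pow_ne_zero _ (by norm_num)
  have hexp : q ^ (2 * n.choose 2 + n) = q ^ n.choose 2 * q ^ n.choose 2 * q ^ n := by
    rw [pow_add, two_mul, pow_add]
  have hcn := pochM_ne_zero (S := smulM d (params c)) (by simpa [smulM] using hmem hc) n
  have han := pochM_ne_zero (S := smulM d (params a)) (by simpa [smulM] using hmem ha) n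
  rw [hexp]
  generalize (d' / d) ^ n = t at *
  generalize (-1 : ℂ) ^ n = ε at *
  generalize q ^ n = u at *
  generalize q ^ n.choose 2 = v at *
  -- The numerator comes from the theta functions, the denominator from the two products shifted by
  -- q^{-n}. The quadratic powers cancel and q^n is left, so the series has argument q.
  have key : t * (v * v * u)⁻¹ / (t * (ε * v)⁻¹ * u⁻¹ * ((ε * v)⁻¹ * u⁻¹)) = u := by
    field_simp
    linear_combination hsq
  conv_rhs => rw [← key]
  simp only [div_eq_mul_inv, mul_inv, inv_inv]
  ring

lemma card_jNum_add {s : ℕ} (a : Fin A → ℂ) (c : Fin (A + 2 + s) → ℂ) (d₁ d₂ q : ℂ)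
    (k : Fin (A + 2 + s)) :
    Multiset.card (jNum a c d₁ d₂ q k) + s = Multiset.card (jDen c q k) + 1 := by
  simp only [jNum, jDen, smulM, divByM, params, paramsErase, Multiset.card_add, Multiset.card_map,
    Finset.card_val, Finset.card_univ, Fintype.card_fin, Finset.card_erase_of_mem (Finset.mem_univ k),
    Multiset.insert_eq_cons, Multiset.card_cons, Multiset.card_singleton]
  omega

lemma residue_eq_phiTerm (hq0 : q ≠ 0) (hq1 : ‖q‖ < 1) {a : Fin A → ℂ} {c : Fin C → ℂ}
    {d₁ d₂ f : ℂ} (hd₁ : d₁ ≠ 0) (hd₂ : d₂ ≠ 0) (hf : f ≠ 0) (hAC : A + 2 ≤ C)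
    (ha : ∀ i, a i ≠ 0) (hc : ∀ k, c k ≠ 0) (k : Fin C)
    (hcd₁ : c k * d₁ ∉ Omega q) (hcd₂ : c k * d₂ ∉ Omega q) (n : ℕ) :
    theta (f * c k * d₁ * q ^ n) q * theta (f / (c k * d₂) * (q ^ n)⁻¹) q
        * pochInfM (smulM (c k * q ^ n)⁻¹ (params a)) q
      / (pochInfM (smulM (c k * q ^ n) {d₁, d₂}) q
        * (pochInfM (smulM (c k * q ^ n)⁻¹ (paramsErase c k)) q
          * (poch (q ^ n)⁻¹ q n * pochInf q q)))
      = (pochInf q q)⁻¹ * (theta (f * c k * d₁) q * theta (f / (c k * d₂)) q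
          * pochInfM (divM (params a) (c k)) q
        / (pochInfM (smulM (c k) {d₁, d₂}) q * pochInfM (divM (paramsErase c k) (c k)) q))
        * phiTerm (jNum a c d₁ d₂ q k) (jDen c q k) q (jArg a c d₁ d₂ q k) n := by
  obtain ⟨s, rfl⟩ := Nat.exists_eq_add_of_le hAC
  have hb := hc k
  have hx : f * c k * d₁ ≠ 0 := mul_ne_zero (mul_ne_zero hf hb) hd₁
  have hy : f / (c k * d₂) ≠ 0 := div_ne_zero hf (mul_ne_zero hb hd₂)
  have hxy : f / (c k * d₂) / (f * c k * d₁) = (c k * c k * d₁ * d₂)⁻¹ := by field_simp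
  have hR : ∀ x ∈ ({d₁, d₂} : Multiset ℂ), c k * x ∉ Omega q := by simp [hcd₁, hcd₂]
  have haM : ∀ x ∈ params a, x ≠ 0 := by simpa [mem_params] using ha
  have hcM : ∀ x ∈ paramsErase c k, x ≠ 0 := by
    intro x hx
    obtain ⟨i, -, rfl⟩ := mem_paramsErase.1 hx
    exact hc i
  have hcardA : Multiset.card (params a) = A := by simp [params]
  have hcardE : Multiset.card (paramsErase c k) + 1 = A + 2 + s := by
    have := congrArg Multiset.card (params_eq_cons_paramsErase c k)
    simpa [params] using this.symm
  have hcardE' : Multiset.card (paramsErase c k) = A + 1 + s := by omega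
  have hprodC : ∏ j, c j = c k * (paramsErase c k).prod := by
    have := congrArg Multiset.prod (params_eq_cons_paramsErase c k)
    rwa [Multiset.prod_cons] at this
  have hprodA : ∏ i, a i = (params a).prod := rfl
  have hE0 : (paramsErase c k).prod ≠ 0 := by
    rw [Ne, Multiset.prod_eq_zero_iff]
    exact fun h => hcM 0 h rfl
  have hs := card_jNum_add a c d₁ d₂ q k
  have hz : ((A + 2 + s : ℕ) : ℤ) - A - 2 = (s : ℕ) := by push_cast; ring
  rw [theta_mul_pow_mul_theta_mul_inv_pow hq0 hq1 hx hy, hxy, poch_inv_pow_eq hq0,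
    pochInfM_smulM_mul_pow hq1 hR, pochInfM_smulM_inv_mul_pow hq0 hq1 hb haM,
    pochInfM_smulM_inv_mul_pow hq0 hq1 hb hcM, phiTerm_eq_of_card hs, jNum, jDen, pochM_add, jArg, hz,
    zpow_natCast, hcardA, hcardE', hprodC, hprodA]
  have hqn := pow_ne_zero n hq0
  have hbn := pow_ne_zero n hb
  have hqc := pow_ne_zero (n.choose 2) hq0
  have hsq : ((-1 : ℂ) ^ n) * (-1) ^ n = 1 := by rw [← mul_pow]; simp
  have hm : ((-1 : ℂ)) ^ n ≠ 0 := pow_ne_zero _ (by norm_num)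
  have hexp : q ^ (2 * n.choose 2 + n)
      = ((-1) ^ n * q ^ n.choose 2) * ((-1) ^ n * q ^ n.choose 2) * q ^ n := by
    rw [pow_add, two_mul, pow_add]
    linear_combination (-(q ^ n.choose 2 * q ^ n.choose 2 * q ^ n)) * hsq
  have hτ : (-1) ^ n * q ^ n.choose 2 ≠ 0 := mul_ne_zero hm hqc
  rw [hexp]
  generalize (-1) ^ n * q ^ n.choose 2 = τ at *
  -- Counting powers of τ: -2 from the theta functions, -A from 𝐚, and A + 1 + s together with 1
  -- from the denominator. The total is s, the exponent in the definition of the series; the rest is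
  -- the n-th power of `jArg`.
  have key : (c k * c k * d₁ * d₂)⁻¹ ^ n * (τ * τ * q ^ n)⁻¹
        * ((params a).prod ^ n * (τ * q ^ n * c k ^ n)⁻¹ ^ A)
      / ((paramsErase c k).prod ^ n * (τ * q ^ n * c k ^ n)⁻¹ ^ (A + 1 + s) * (τ⁻¹ * (q ^ n)⁻¹))
      = τ ^ s * (q * (q * c k) ^ s * (params a).prod
        / (d₁ * d₂ * (c k * (paramsErase c k).prod))) ^ n := by
    have hE := pow_ne_zero n hE0
    have h1 := pow_ne_zero n hd₁
    have h2 := pow_ne_zero n hd₂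
    simp only [div_pow, mul_pow, inv_pow, mul_inv, pow_add, pow_one]
    rw [← pow_mul q s n, ← pow_mul (c k) s n, mul_comm s n, pow_mul, pow_mul]
    generalize q ^ n = u at *
    generalize c k ^ n = v at *
    field_simp
  rw [← key]
  simp only [div_eq_mul_inv, mul_inv, inv_inv]
  ring

end Terms

/-! ### The integrand as a kernel in two ways, and evaluation of the integral -/

section Main

variable {q : ℂ} {A C : ℕ}

lemma pochInfM_smulM_pair (b x y q : ℂ) :
    pochInfM (smulM b {x, y}) q = pochInf (b * x) q * pochInf (b * y) q := by
  simp [pochInfM_smulM]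

lemma params_pair (d₁ d₂ : ℂ) : params ![d₁, d₂] = {d₁, d₂} := rfl

lemma paramsErase_pair_zero (d₁ d₂ : ℂ) : paramsErase ![d₁, d₂] 0 = {d₂} := rfl

lemma paramsErase_pair_one (d₁ d₂ : ℂ) : paramsErase ![d₁, d₂] 1 = {d₁} := rfl

lemma integrand_eq_kernel (a : Fin A → ℂ) (c : Fin C → ℂ) (d₁ d₂ f q : ℂ) (σ ψ : ℝ) :
    integrand a c d₁ d₂ f q σ ψ = kernel ({f / d₂, q / (f * d₁)} + params a) {f * d₁, q / f * d₂}
      (params c) (params ![d₁, d₂]) q ((σ⁻¹ : ℝ) * Complex.exp (Complex.I * ψ)) := by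
  have h1 : ((σ⁻¹ : ℝ) * Complex.exp (Complex.I * ψ) : ℂ) = Complex.exp (Complex.I * ψ) / σ := by
    push_cast
    rw [div_eq_mul_inv, mul_comm]
  rw [h1]
  simp only [integrand, kernel, inv_div, params_pair]
  congr 1 <;> ring

/-- The variable σ/z replaces z/σ, exchanging inside and outside: the progressions from 𝐜, not those
from 𝐝, now lie inside the circle. -/
lemma integrand_eq_kernel_inv (a : Fin A → ℂ) (c : Fin C → ℂ) (d₁ d₂ f q : ℂ) (σ ψ : ℝ) :
    integrand a c d₁ d₂ f q σ ψ = kernel {f * d₁, q / f * d₂} ({f / d₂, q / (f * d₁)} + params a)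
      {d₁, d₂} (params c) q (σ * Complex.exp (Complex.I * (-ψ : ℝ))) := by
  have h1 : (σ * Complex.exp (Complex.I * (-ψ : ℝ)) : ℂ) = σ / Complex.exp (Complex.I * ψ) := by
    push_cast
    rw [mul_neg, Complex.exp_neg, div_eq_mul_inv]
  rw [h1]
  simp only [integrand, kernel, inv_div]

lemma continuous_integrand (hq0 : q ≠ 0) (hq1 : ‖q‖ < 1) (a : Fin A → ℂ) {c : Fin C → ℂ}
    {d₁ d₂ : ℂ} (f : ℂ) {σ : ℝ} (hσ : 0 < σ) (hcσ : ∀ k, ‖c k‖ < σ) (hd₁σ : ‖d₁‖ < 1 / σ)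
    (hd₂σ : ‖d₂‖ < 1 / σ) : Continuous (integrand a c d₁ d₂ f q σ) := by
  rw [show integrand a c d₁ d₂ f q σ = fun ψ => _ from
    funext fun ψ => integrand_eq_kernel a c d₁ d₂ f q σ ψ]
  rw [continuous_iff_continuousAt]
  intro ψ
  have hnorm : ‖((σ⁻¹ : ℝ) * Complex.exp (Complex.I * ψ) : ℂ)‖ = σ⁻¹ := by
    rw [norm_mul, mul_comm Complex.I, Complex.norm_exp_ofReal_mul_I, mul_one, Complex.norm_real,
      Real.norm_of_nonneg (inv_nonneg.2 hσ.le)]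
  refine ContinuousAt.comp (g := kernel _ _ _ _ q)
    (f := fun ψ : ℝ => ((σ⁻¹ : ℝ) * Complex.exp (Complex.I * ψ) : ℂ)) ?_
    (Continuous.continuousAt (by fun_prop))
  refine (differentiableAt_kernel hq1 _ _ ?_ (fun x hx => ?_) fun x hx => ?_).continuousAt
  · rw [← norm_pos_iff, hnorm]
    exact inv_pos.2 hσ
  · obtain ⟨k, rfl⟩ := mem_params.1 hx
    refine notMem_Omega_of_norm_lt_one hq0 hq1 ?_
    rw [norm_mul, hnorm, inv_mul_lt_one₀ hσ]
    exact hcσ k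
  · refine notMem_Omega_of_norm_lt_one hq0 hq1 ?_
    rw [norm_mul, norm_inv, hnorm, inv_inv, mul_comm, ← lt_div_iff₀ hσ]
    rw [params_pair] at hx
    rcases (by simpa using hx : x = d₁ ∨ x = d₂) with rfl | rfl
    · exact hd₁σ
    · exact hd₂σ

lemma kernelResidue_pair_zero (hq0 : q ≠ 0) (hq1 : ‖q‖ < 1) {a : Fin A → ℂ} {c : Fin C → ℂ}
    {d₁ d₂ f : ℂ} (hd₁ : d₁ ≠ 0) (hd₂ : d₂ ≠ 0) (hf : f ≠ 0)
    (ha : ∀ i, d₁ * a i ∉ Omega q) (hc : ∀ k, d₁ * c k ∉ Omega q) (n : ℕ) :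
    kernelResidue ({f / d₂, q / (f * d₁)} + params a) {f * d₁, q / f * d₂} (params c) ![d₁, d₂]
        q 0 n
      = theta f q * theta (f * (d₁ / d₂)) q / pochInf q q * (pochInfM (smulM d₁ (params a)) q
        / (pochInf (d₂ / d₁) q * pochInfM (smulM d₁ (params c)) q)) * hTerm a c d₁ d₂ q n := by
  have hqn := pow_ne_zero n hq0
  have h := residue_eq_hTerm hq0 hq1 (x := f * (d₁ / d₂)) (y := f) hd₁ hd₂
    (mul_ne_zero hf (div_ne_zero hd₁ hd₂)) hf (by field_simp) ha hc n
  rw [mul_comm (theta f q), ← h]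
  simp only [kernelResidue, Matrix.cons_val_zero, paramsErase_pair_zero, smulM_add, pochInfM_add,
    pochInfM_smulM_pair, theta]
  rw [show pochInfM (smulM (d₁ * q ^ n)⁻¹ {d₂}) q = pochInf ((d₁ * q ^ n)⁻¹ * d₂) q by
      simp [pochInfM_smulM],
    show d₁ * q ^ n * (f / d₂) = f * (d₁ / d₂) * q ^ n by ring,
    show d₁ * q ^ n * (q / (f * d₁)) = q / (f * (q ^ n)⁻¹) by field_simp,
    show (d₁ * q ^ n)⁻¹ * (f * d₁) = f * (q ^ n)⁻¹ by field_simp,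
    show (d₁ * q ^ n)⁻¹ * (q / f * d₂) = q / (f * (d₁ / d₂) * q ^ n) by field_simp]
  ring

lemma kernelResidue_pair_one (hq0 : q ≠ 0) (hq1 : ‖q‖ < 1) {a : Fin A → ℂ} {c : Fin C → ℂ}
    {d₁ d₂ f : ℂ} (hd₁ : d₁ ≠ 0) (hd₂ : d₂ ≠ 0) (hf : f ≠ 0)
    (ha : ∀ i, d₂ * a i ∉ Omega q) (hc : ∀ k, d₂ * c k ∉ Omega q) (n : ℕ) :
    kernelResidue ({f / d₂, q / (f * d₁)} + params a) {f * d₁, q / f * d₂} (params c) ![d₁, d₂]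
        q 1 n
      = theta f q * theta (f * (d₁ / d₂)) q / pochInf q q * (pochInfM (smulM d₂ (params a)) q
        / (pochInf (d₁ / d₂) q * pochInfM (smulM d₂ (params c)) q)) * hTerm a c d₂ d₁ q n := by
  have hqn := pow_ne_zero n hq0
  have h := residue_eq_hTerm hq0 hq1 (x := f) (y := f * (d₁ / d₂)) hd₂ hd₁ hf
    (mul_ne_zero hf (div_ne_zero hd₁ hd₂)) (by field_simp) ha hc n
  rw [← h]
  simp only [kernelResidue, Matrix.cons_val_one, Matrix.cons_val_zero, paramsErase_pair_one,
    smulM_add, pochInfM_add, pochInfM_smulM_pair, theta]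
  rw [show pochInfM (smulM (d₂ * q ^ n)⁻¹ {d₁}) q = pochInf ((d₂ * q ^ n)⁻¹ * d₁) q by
      simp [pochInfM_smulM],
    show d₂ * q ^ n * (f / d₂) = f * q ^ n by field_simp,
    show d₂ * q ^ n * (q / (f * d₁)) = q / (f * (d₁ / d₂) * (q ^ n)⁻¹) by field_simp,
    show (d₂ * q ^ n)⁻¹ * (f * d₁) = f * (d₁ / d₂) * (q ^ n)⁻¹ by field_simp,
    show (d₂ * q ^ n)⁻¹ * (q / f * d₂) = q / (f * q ^ n) by field_simp]
  ring

lemma kernelResidue_inv (hq0 : q ≠ 0) (hq1 : ‖q‖ < 1) {a : Fin A → ℂ} {c : Fin C → ℂ}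
    {d₁ d₂ f : ℂ} (hd₁ : d₁ ≠ 0) (hd₂ : d₂ ≠ 0) (hf : f ≠ 0) (hAC : A + 2 ≤ C)
    (ha : ∀ i, a i ≠ 0) (hc : ∀ k, c k ≠ 0) (k : Fin C)
    (hcd₁ : c k * d₁ ∉ Omega q) (hcd₂ : c k * d₂ ∉ Omega q) (n : ℕ) :
    kernelResidue {f * d₁, q / f * d₂} ({f / d₂, q / (f * d₁)} + params a) {d₁, d₂} c q k n
      = (pochInf q q)⁻¹ * (theta (f * c k * d₁) q * theta (f / (c k * d₂)) q
          * pochInfM (divM (params a) (c k)) q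
        / (pochInfM (smulM (c k) {d₁, d₂}) q * pochInfM (divM (paramsErase c k) (c k)) q))
        * phiTerm (jNum a c d₁ d₂ q k) (jDen c q k) q (jArg a c d₁ d₂ q k) n := by
  have hqn := pow_ne_zero n hq0
  have hb := hc k
  rw [← residue_eq_phiTerm hq0 hq1 hd₁ hd₂ hf hAC ha hc k hcd₁ hcd₂ n]
  simp only [kernelResidue, smulM_add, pochInfM_add, pochInfM_smulM_pair, theta]
  rw [show c k * q ^ n * (f * d₁) = f * c k * d₁ * q ^ n by ring,
    show c k * q ^ n * (q / f * d₂) = q / (f / (c k * d₂) * (q ^ n)⁻¹) by field_simp,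
    show (c k * q ^ n)⁻¹ * (f / d₂) = f / (c k * d₂) * (q ^ n)⁻¹ by field_simp,
    show (c k * q ^ n)⁻¹ * (q / (f * d₁)) = q / (f * c k * d₁ * q ^ n) by field_simp]
  ring

/-- The integral as a sum over the poles `d₁ q ^ n`, `d₂ q ^ n`. -/
theorem integral_integrand_eq_H (hq0 : q ≠ 0) (hq1 : ‖q‖ < 1) {a : Fin A → ℂ} {c : Fin C → ℂ}
    {d₁ d₂ f : ℂ} (hd₁ : d₁ ≠ 0) (hd₂ : d₂ ≠ 0) (hf : f ≠ 0) {σ : ℝ} (hσ : 0 < σ)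
    (hcσ : ∀ k, ‖c k‖ < σ) (hd₁σ : ‖d₁‖ < 1 / σ) (hd₂σ : ‖d₂‖ < 1 / σ)
    (hcd₁ : ∀ k, d₁ * c k ∉ Omega q) (hcd₂ : ∀ k, d₂ * c k ∉ Omega q)
    (h12 : d₁ / d₂ ∉ Omega q) (h21 : d₂ / d₁ ∉ Omega q)
    (ha : ∀ i, d₁ * a i ∉ Omega q ∧ d₂ * a i ∉ Omega q) :
    ∫ ψ in (-Real.pi)..Real.pi, integrand a c d₁ d₂ f q σ ψ
      = 2 * Real.pi * (theta f q * theta (f * (d₁ / d₂)) q) / pochInf q q * H a c d₁ d₂ q := by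
  have hres0 := kernelResidue_pair_zero (f := f) hq0 hq1 hd₁ hd₂ hf (fun i => (ha i).1) hcd₁
  have hres1 := kernelResidue_pair_one (f := f) hq0 hq1 hd₁ hd₂ hf (fun i => (ha i).2) hcd₂
  have hs0 := summable_hTerm hq0 hq1 c h12 fun i => (ha i).1
  have hs1 := summable_hTerm hq0 hq1 c h21 fun i => (ha i).2
  simp only [integrand_eq_kernel]
  rw [integral_kernel hq0 hq1 _ (e := ![d₁, d₂]) (by simp [Fin.forall_fin_two, hd₁, hd₂])
    (by simp [Fin.forall_fin_two, h12, h21]) (inv_pos.2 hσ)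
    (by rw [inv_eq_one_div]; exact Fin.forall_fin_two.2 ⟨hd₁σ, hd₂σ⟩)
    (fun x hx => by
      obtain ⟨k, rfl⟩ := mem_params.1 hx
      rw [← div_eq_mul_inv, div_lt_one hσ]
      exact hcσ k)
    (by simp)
    (fun _ => by
      have hpos : 0 < ‖d₁ * d₂‖ := norm_pos_iff.2 (mul_ne_zero hd₁ hd₂)
      -- The parameter f cancels in the product, so the limiting decay ratio is q and no condition
      -- on 𝐚 or 𝐜 is needed.
      have h1 : (({f * d₁, q / f * d₂} : Multiset ℂ)).prod = q * (d₁ * d₂) := by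
        simp only [Multiset.insert_eq_cons, Multiset.prod_cons, Multiset.prod_singleton]
        field_simp
      rw [h1, Fin.prod_univ_two, norm_mul]
      exact mul_lt_of_lt_one_left hpos hq1)
    (Fin.forall_fin_two.2 ⟨(hs0.mul_left _).congr fun n => (hres0 n).symm,
      (hs1.mul_left _).congr fun n => (hres1 n).symm⟩),
    Fin.sum_univ_two]
  simp only [hres0, hres1, tsum_mul_left]
  rw [H, hSummand, hSummand]
  change _ = _ * (_ * (∑' n, hTerm a c d₁ d₂ q n) + _ * ∑' n, hTerm a c d₂ d₁ q n)
  ring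

lemma notMem_Omega_of_mem_jDen (hq0 : q ≠ 0) {c : Fin C → ℂ}
    (hne : ∀ k k', k ≠ k' → c k / c k' ∉ Omega q) (k : Fin C) :
    ∀ x ∈ jDen c q k, x ∉ Omega q := by
  intro x hx
  simp only [jDen, divByM, Multiset.mem_map, mem_paramsErase] at hx
  obtain ⟨_, ⟨i, hi, rfl⟩, rfl⟩ := hx
  rw [mul_div_assoc]
  exact mul_notMem_Omega hq0 (hne k i hi.symm)

/-- The integral as a sum over the poles `1 / (c k q ^ n)`. -/
theorem integral_integrand_eq_J (hq0 : q ≠ 0) (hq1 : ‖q‖ < 1) {a : Fin A → ℂ} {c : Fin C → ℂ}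
    {d₁ d₂ f : ℂ} (hd₁ : d₁ ≠ 0) (hd₂ : d₂ ≠ 0) (hf : f ≠ 0) {σ : ℝ} (hσ : 0 < σ)
    (hcσ : ∀ k, ‖c k‖ < σ) (hd₁σ : ‖d₁‖ < 1 / σ) (hd₂σ : ‖d₂‖ < 1 / σ)
    (hcd₁ : ∀ k, c k * d₁ ∉ Omega q) (hcd₂ : ∀ k, c k * d₂ ∉ Omega q)
    (hAC : A + 2 ≤ C) (ha : ∀ i, a i ≠ 0) (hc : ∀ k, c k ≠ 0)
    (hne : ∀ k k', k ≠ k' → c k / c k' ∉ Omega q)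
    (hprod : C = A + 2 → ‖q * ∏ i, a i‖ < ‖d₁ * d₂ * ∏ k, c k‖)
    (hsum : ∀ k, Summable (phiTerm (jNum a c d₁ d₂ q k) (jDen c q k) q (jArg a c d₁ d₂ q k))) :
    ∫ ψ in (-Real.pi)..Real.pi, integrand a c d₁ d₂ f q σ ψ
      = 2 * Real.pi / pochInf q q * J a c d₁ d₂ f q := by
  have hres := fun k => kernelResidue_inv (f := f) hq0 hq1 hd₁ hd₂ hf hAC ha hc k (hcd₁ k) (hcd₂ k)
  have hcardQ : Multiset.card (({f / d₂, q / (f * d₁)} : Multiset ℂ) + params a) = A + 2 := by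
    simp only [params, Multiset.insert_eq_cons, Multiset.card_add, Multiset.card_cons,
      Multiset.card_singleton, Multiset.card_map, Finset.card_val, Finset.card_univ, Fintype.card_fin]
    omega
  simp only [integrand_eq_kernel_inv]
  -- The point σ/z runs through its circle with angle -ψ; reflection preserves the symmetric
  -- interval.
  rw [intervalIntegral.integral_comp_neg fun ψ : ℝ => kernel {f * d₁, q / f * d₂}
      ({f / d₂, q / (f * d₁)} + params a) {d₁, d₂} (params c) q
      (σ * Complex.exp (Complex.I * ψ)), neg_neg,
    integral_kernel hq0 hq1 _ hc hne hσ hcσ (by simp [← lt_div_iff₀ hσ, -one_div, hd₁σ, hd₂σ])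
      (by rwa [hcardQ])
      (fun h => by
        have hdd : 0 < ‖d₁ * d₂‖ := norm_pos_iff.2 (mul_ne_zero hd₁ hd₂)
        have h1 : (({f / d₂, q / (f * d₁)} : Multiset ℂ) + params a).prod
            = q * (∏ i, a i) / (d₁ * d₂) := by
          rw [Multiset.prod_add]
          simp only [Multiset.insert_eq_cons, Multiset.prod_cons, Multiset.prod_singleton]
          rw [show (params a).prod = ∏ i, a i from rfl]
          field_simp
        -- In the balanced case C = A + 2 the decay condition is exactly the assumed inequality,
        -- again with f cancelled.
        rw [h1, norm_div, div_lt_iff₀ hdd, mul_comm ‖∏ j, c j‖, ← norm_mul]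
        exact hprod (by rw [← h, hcardQ]))
      (fun k => ((hsum k).mul_left _).congr fun n => (hres k n).symm)]
  simp only [hres, tsum_mul_left, J, Finset.mul_sum]
  refine Finset.sum_congr rfl fun k _ => ?_
  rw [phi]
  ring

end Main

end QHyp

end

theorem mainTheorem2 (q : ℂ) (hq0 : q ≠ 0) (hq1 : ‖q‖ < 1) (A C : ℕ)
    (a : Fin A → ℂ) (c : Fin C → ℂ) (d₁ d₂ f : ℂ) (hd₁ : d₁ ≠ 0) (hd₂ : d₂ ≠ 0) (hf : f ≠ 0)
    (σ : ℝ) (hσ : 0 < σ) (hcσ : ∀ k, ‖c k‖ < σ) (hd₁σ : ‖d₁‖ < 1 / σ) (hd₂σ : ‖d₂‖ < 1 / σ) :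
    IntervalIntegrable (QHyp.integrand a c d₁ d₂ f q σ) volume (-Real.pi) Real.pi ∧
    (d₁ / d₂ ∉ QHyp.Omega q → d₂ / d₁ ∉ QHyp.Omega q →
      (∀ i, d₁ * a i ∉ QHyp.Omega q ∧ d₂ * a i ∉ QHyp.Omega q) →
      Summable (QHyp.hTerm a c d₁ d₂ q) ∧ Summable (QHyp.hTerm a c d₂ d₁ q) ∧
      ∫ ψ in (-Real.pi)..Real.pi, QHyp.integrand a c d₁ d₂ f q σ ψ
        = 2 * Real.pi * (QHyp.theta f q * QHyp.theta (f * (d₁ / d₂)) q) / QHyp.pochInf q q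
          * QHyp.H a c d₁ d₂ q) ∧
    (A + 2 ≤ C → (∀ i, a i ≠ 0) → (∀ k, c k ≠ 0) →
      (∀ k k', k ≠ k' → c k / c k' ∉ QHyp.Omega q) →
      (C = A + 2 → ‖q * ∏ i, a i‖ < ‖d₁ * d₂ * ∏ k, c k‖) →
      (∀ k, Summable
        (QHyp.phiTerm (QHyp.jNum a c d₁ d₂ q k) (QHyp.jDen c q k) q (QHyp.jArg a c d₁ d₂ q k))) ∧
      (A + 2 < C → ∀ k,
        (∀ x, Summable (QHyp.phiTerm (QHyp.jNum a c d₁ d₂ q k) (QHyp.jDen c q k) q x)) ∧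
        Differentiable ℂ (QHyp.phi (QHyp.jNum a c d₁ d₂ q k) (QHyp.jDen c q k) q)) ∧
      ∫ ψ in (-Real.pi)..Real.pi, QHyp.integrand a c d₁ d₂ f q σ ψ
        = 2 * Real.pi / QHyp.pochInf q q * QHyp.J a c d₁ d₂ f q) := by
  -- Since |c_k d| < 1, no factor of (c_k d;q)_∞ vanishes; the poles from 𝐜 and from 𝐝 lie on
  -- opposite sides of the contour.
  have hcd : ∀ d : ℂ, ‖d‖ < 1 / σ → ∀ k, c k * d ∉ QHyp.Omega q := fun d hd k => by
    refine QHyp.notMem_Omega_of_norm_lt_one hq0 hq1 ?_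
    rw [norm_mul]
    calc ‖c k‖ * ‖d‖ ≤ σ * ‖d‖ := mul_le_mul_of_nonneg_right (hcσ k).le (norm_nonneg _)
      _ < σ * (1 / σ) := mul_lt_mul_of_pos_left hd hσ
      _ = 1 := mul_one_div_cancel hσ.ne'
  have hdc : ∀ d : ℂ, ‖d‖ < 1 / σ → ∀ k, d * c k ∉ QHyp.Omega q := fun d hd k => by
    rw [mul_comm]
    exact hcd d hd k
  refine ⟨(QHyp.continuous_integrand hq0 hq1 a f hσ hcσ hd₁σ hd₂σ).intervalIntegrable _ _,
    fun h12 h21 ha => ⟨QHyp.summable_hTerm hq0 hq1 c h12 fun i => (ha i).1,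
      QHyp.summable_hTerm hq0 hq1 c h21 fun i => (ha i).2,
      QHyp.integral_integrand_eq_H hq0 hq1 hd₁ hd₂ hf hσ hcσ hd₁σ hd₂σ (hdc d₁ hd₁σ) (hdc d₂ hd₂σ)
        h12 h21 ha⟩, fun hAC ha hc hne hprod => ?_⟩
  have hden := QHyp.notMem_Omega_of_mem_jDen hq0 hne
  have hsum : ∀ k, Summable (QHyp.phiTerm (QHyp.jNum a c d₁ d₂ q k) (QHyp.jDen c q k) q
      (QHyp.jArg a c d₁ d₂ q k)) := by
    intro k
    obtain ⟨s, rfl⟩ := Nat.exists_eq_add_of_le hAC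
    refine (QHyp.summable_norm_phiTerm hq0 hq1 (QHyp.card_jNum_add a c d₁ d₂ q k) (hden k)
      fun hs => ?_).of_norm
    -- For s = 0, that is C = A + 2, the series needs an argument of modulus below 1; the argument
    -- no longer depends on k and the assumed inequality says just this.
    subst hs
    have hpos := (norm_nonneg _).trans_lt (hprod rfl)
    have hz : ((A + 2 + 0 : ℕ) : ℤ) - A - 2 = 0 := by push_cast; ring
    rw [QHyp.jArg, hz, zpow_zero, mul_one, norm_div, div_lt_one hpos]
    exact hprod rfl
  refine ⟨hsum, fun hlt k => ?_, QHyp.integral_integrand_eq_J hq0 hq1 hd₁ hd₂ hf hσ hcσ hd₁σ hd₂σ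
    (hcd d₁ hd₁σ) (hcd d₂ hd₂σ) hAC ha hc hne hprod hsum⟩
  obtain ⟨s, rfl⟩ := Nat.exists_eq_add_of_le hAC
  have hs0 : s ≠ 0 := by omega
  have hs := QHyp.card_jNum_add a c d₁ d₂ q k
  exact ⟨fun x => (QHyp.summable_norm_phiTerm hq0 hq1 hs (hden k) fun h => absurd h hs0).of_norm,
    QHyp.differentiable_phi hq0 hq1 hs hs0 (hden k)⟩
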